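/- Long-time limit. Let $\Pi_{\rm in}$ be a Poisson point set on $(-\infty,0]\times[0,\infty)$ with intensity one and let $\Pi_{\rm out}$ be an independent Poisson point set on $[0,\infty)$ with intensity one. A point $(p,t)\in\Pi_{\rm in}$ is a task with priority $p$ that arrives at time $t$, and $\Pi_{\rm out}$ is the set of execution times. A subset of a topological space is called locally finite if it meets every compact set in a finite set. Let $Y(0)$ be a locally finite subset of $(-\infty,0]$ (deterministic, or random and independent of $(\Pi_{\rm in},\Pi_{\rm out})$), and let $(Y(t))_{t\ge 0}$ be the inbox process started from $Y(0)$: it takes values in the locally finite subsets of $(-\infty,0]$ and, for every $\lambda\ge 0$, almost surely the process $Y^\lambda(t):=Y(t)\cap[-\lambda,0]$ is right-continuous, has $Y^\lambda(t)=Y^\lambda(t-)\cup\{p\}$ for each $(p,t)\in\Pi_{\rm in}$ with $p\in[-\lambda,0]$, has $Y^\lambda(t)=Y^\lambda(t-)\setminus\{\max Y^\lambda(t-)\}$ for each $t\in\Pi_{\rm out}$ (nothing happens if $Y^\lambda(t-)=\emptyset$), and does not change at any other time. Then there exists a random, locally finite subset $Y^1(\infty)\subset(-1,0]$ such that, regardless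 of the initial state $Y(0)$, for every $0<\lambda<1$ the law of $Y^\lambda(t)$ converges, as $t\to\infty$, in total variation norm to the law of $Y^1(\infty)\cap[-\lambda,0]$. The set $Y^1(\infty)$ almost surely has infinitely many elements. Writing $N^\lambda(\infty):=|Y^1(\infty)\cap[-\lambda,0]|$, one has $$\mathbb P\big[N^\lambda(\infty)=n\big]=(1-\lambda)\lambda^n\qquad(0\le\lambda<1,\ n\ge 0).$$ -/

import Mathlib

open MeasureTheory ProbabilityTheory Filter Topology Set
open scoped NNReal ENNReal

/-- The locally finite subsets of the subspace `S` of `E`: subsets of `S` that meet every compact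
subset of `S` in a finite set. -/
def LocFin {E : Type*} [TopologicalSpace E] (S : Set E) : Type _ :=
  {y : Set E // y ⊆ S ∧ ∀ K : Set E, K ⊆ S → IsCompact K → (y ∩ K).Finite}

namespace LocFin

/-- The underlying set of points. -/
def pts {E : Type*} [TopologicalSpace E] {S : Set E} (y : LocFin S) : Set E := y.1

/-- The number of points of `y` in `B`, possibly infinite. -/
noncomputable def count {E : Type*} [TopologicalSpace E] {S : Set E} (B : Set E)
    (y : LocFin S) : ℕ∞ :=
  (y.pts ∩ B).encard

/-- The usual sigma-algebra on locally finite sets, generated by the numbers of points in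
Borel sets. -/
noncomputable instance {E : Type*} [TopologicalSpace E] [MeasurableSpace E] (S : Set E) :
    MeasurableSpace (LocFin S) :=
  ⨆ (B : Set E) (_ : MeasurableSet B), MeasurableSpace.comap (count B) inferInstance

/-- Intersecting a locally finite subset of `S` with a smaller window `T ⊆ S`. -/
def restrict {E : Type*} [TopologicalSpace E] {S T : Set E} (h : T ⊆ S) (y : LocFin S) :
    LocFin T :=
  ⟨y.pts ∩ T, inter_subset_right, fun K hK hc =>
    (y.2.2 K (hK.trans h) hc).subset (inter_subset_inter_left K inter_subset_left)⟩

end LocFin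

/-- The random locally finite set `X` is a Poisson point set with intensity measure `m`: the
number of points in a Borel set `B` with `m B < ∞` has the Poisson law with mean `m B`, and the
numbers of points in finitely many pairwise disjoint Borel sets are independent. -/
structure IsPoissonPointSet {Ω E : Type*} [MeasurableSpace Ω] [TopologicalSpace E]
    [MeasurableSpace E] {S : Set E} (P : Measure Ω) (m : Measure E) (X : Ω → LocFin S) :
    Prop where
  measurable : Measurable X
  poisson : ∀ B : Set E, MeasurableSet B → m B < ∞ →
    P.map (fun ω => (X ω).count B) =
      (poissonMeasure (m B).toNNReal).map (fun n : ℕ => (n : ℕ∞))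
  indep : ∀ (k : ℕ) (B : Fin k → Set E), (∀ i, MeasurableSet (B i)) →
    (Pairwise fun i j => Disjoint (B i) (B j)) →
    iIndepFun (fun i ω => (X ω).count (B i)) P

/-- The function `X` is the trajectory of the inbox with rate `lam` of incoming tasks, initial
state `y₀`, incoming tasks `(p, t) ∈ A` (priority, time) with `p ∈ [-lam, 0]` and execution times
`D`. The set `L` below is the state immediately prior to time `t`. -/
structure IsInboxPath (lam : ℝ) (y₀ : Set ℝ) (A : Set (ℝ × ℝ)) (D : Set ℝ) (X : ℝ → Set ℝ) :
    Prop where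
  finite : ∀ t, 0 ≤ t → X t ⊆ Icc (-lam) 0 ∧ (X t).Finite
  initial : X 0 = y₀
  right_continuous : ∀ t, 0 ≤ t → ∀ᶠ s in 𝓝[>] t, X s = X t
  rules : ∀ t, 0 < t → ∃ L : Set ℝ, (∀ᶠ s in 𝓝[<] t, X s = L) ∧
    (∀ p ∈ Icc (-lam) 0, (p, t) ∈ A → X t = L ∪ {p}) ∧
    (t ∈ D → X t = L \ {q | IsGreatest L q}) ∧
    ((∀ p ∈ Icc (-lam) 0, (p, t) ∉ A) → t ∉ D → X t = L)

/-- `Y` is the inbox process driven by `Pin`, a Poisson point set with intensity one on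
`(-∞, 0] × [0, ∞)` giving the priorities and arrival times of the incoming tasks, and `Pout`, an
independent Poisson point set with intensity one on `[0, ∞)` giving the execution times. The
initial state `Y 0` may be any locally finite random subset of `(-∞, 0]` independent of the driving
noise, for instance any deterministic one. -/
structure IsInboxProcess {Ω : Type*} [MeasurableSpace Ω] (P : Measure Ω)
    (Pin : Ω → LocFin (Iic (0 : ℝ) ×ˢ Ici (0 : ℝ))) (Pout : Ω → LocFin (Ici (0 : ℝ)))
    (Y : ℝ → Ω → LocFin (Iic (0 : ℝ))) : Prop where
  poisson_in : IsPoissonPointSet P (volume.restrict (Iic (0 : ℝ) ×ˢ Ici (0 : ℝ))) Pin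
  poisson_out : IsPoissonPointSet P (volume.restrict (Ici (0 : ℝ))) Pout
  indep_in_out : IndepFun Pin Pout P
  measurable : ∀ t, 0 ≤ t → Measurable (Y t)
  indep_initial : IndepFun (Y 0) (fun ω => (Pin ω, Pout ω)) P
  path : ∀ lam : ℝ, 0 ≤ lam → ∀ᵐ ω ∂P,
    IsInboxPath lam ((Y 0 ω).pts ∩ Icc (-lam) 0) (Pin ω).pts (Pout ω).pts
      (fun t => (Y t ω).pts ∩ Icc (-lam) 0)

/-- Distance of two finite measures in the total variation norm. -/
noncomputable def tvDist {α : Type*} [MeasurableSpace α] (μ ν : Measure α) [IsFiniteMeasure μ]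
    [IsFiniteMeasure ν] : ℝ≥0∞ :=
  (μ.toSignedMeasure - ν.toSignedMeasure).totalVariation univ

/-- The window `[-lam, 0]` lies in `(-1, 0]` if `lam < 1`. -/
theorem window_subset {lam : ℝ} (h : lam < 1) : Icc (-lam) 0 ⊆ Ioc (-1 : ℝ) 0 :=
  fun _ hx => ⟨lt_of_lt_of_le (neg_lt_neg h) hx.1, hx.2⟩

/-! Tasks with priority below `-lam` never affect the window `[-lam, 0]`, so the inbox restricted to
a window is a Markov process of its own, with arrivals at rate `lam` and executions at rate one. For
`lam < 1` its size is dominated by a random walk with negative drift, reflected at zero.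

Consider first the embedded chain, driven by i.i.d. marks of law `markLaw`, the same marks for all
windows. Read the marks backward from the present. The backward walk tends to `-∞` (`tendsto_walk`),
hence has a maximum, and at the time of this maximum every inbox started far enough in the past is
empty (`back_eq_of_isMax`). The present state therefore forgets its start: coupling from the past
defines `stationary` consistently in all windows, and the probability that coalescence is late
bounds the distance to stationarity (`iterate_stepOp_indicator_le`). Invariance, tested on the
events that the size exceeds `n`, shows that consecutive size probabilities have ratio `lam`
(`sizeProb_succ`). This gives the geometric law; letting `lam` increase to one then excludes finite
stationary inboxes.

For continuous time, `[0, t]` is cut into `m` equal slots. The marks of the slots are exactly i.i.d.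
(`map_slotMarks`), and the resulting chain is a lazy version of the embedded one (`stepOp_slotLaw`).
The marks describe the true evolution unless some slot has two events, which has probability of
order `1 / m`. A generating function bound (`iterate_lazy_le`) controls the event that fewer than
`J` embedded steps occur. As `m → ∞`, what remains is the coupling error after `J` steps plus `2 ^ J
* exp (-t)` (`measure_window_le_exp`). -/

namespace LocFin

/-! ### Counts and measurability for locally finite sets -/

section Basic

variable {E : Type*} [TopologicalSpace E] {S T : Set E}

theorem ext_pts {y z : LocFin S} (h : y.pts = z.pts) : y = z := Subtype.ext h

theorem pts_subset (y : LocFin S) : y.pts ⊆ S := y.2.1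

@[simp] theorem pts_restrict (h : T ⊆ S) (y : LocFin S) : (y.restrict h).pts = y.pts ∩ T := rfl

theorem count_restrict (h : T ⊆ S) (y : LocFin S) (B : Set E) :
    (y.restrict h).count B = y.count (T ∩ B) := by
  simp only [count, pts_restrict, inter_assoc]

theorem count_ne_zero {y : LocFin S} {B : Set E} : y.count B ≠ 0 ↔ ∃ p ∈ y.pts, p ∈ B := by
  rw [count, Set.encard_ne_zero]; rfl

theorem count_eq_zero {y : LocFin S} {B : Set E} : y.count B = 0 ↔ ∀ p ∈ y.pts, p ∉ B := by
  rw [← not_iff_not, ← ne_eq, count_ne_zero]; push Not; rfl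

variable [MeasurableSpace E]

theorem measurable_count {B : Set E} (hB : MeasurableSet B) :
    Measurable (count B : LocFin S → ℕ∞) :=
  (comap_measurable (count B)).mono (le_iSup₂_of_le B hB le_rfl) le_rfl

theorem measurable_of_count {α : Type*} [MeasurableSpace α] {f : α → LocFin S}
    (hf : ∀ B, MeasurableSet B → Measurable fun a => (f a).count B) : Measurable f := by
  refine Measurable.of_le_map (iSup₂_le fun B hB => ?_)
  rw [← measurable_iff_le_map, measurable_iff_comap_le, MeasurableSpace.comap_comp]
  exact (hf B hB).comap_le

theorem measurable_restrict (h : T ⊆ S) (hT : MeasurableSet T) :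
    Measurable (restrict h : LocFin S → LocFin T) :=
  measurable_of_count fun B hB => by
    simpa only [count_restrict] using measurable_count (hT.inter hB)

end Basic

end LocFin

/-! ### Inbox states in a window and the action of a mark -/

/-- The states of the inbox restricted to priorities in `[-lam, 0]`. -/
abbrev Inbox (lam : ℝ) := LocFin (Icc (-lam) (0 : ℝ))

namespace Inbox

open LocFin

variable {lam : ℝ}

theorem finite (y : Inbox lam) : y.pts.Finite := by
  have : (y.pts ∩ Icc (-lam) 0).Finite := y.2.2 (Icc (-lam) 0) Subset.rfl isCompact_Icc
  rwa [inter_eq_left.2 y.pts_subset] at this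

/-- The inbox with the given finite set of points. -/
def ofFinite (s : Set ℝ) (hs : s ⊆ Icc (-lam) 0) (hf : s.Finite) : Inbox lam :=
  ⟨s, hs, fun _ _ _ => hf.subset inter_subset_left⟩

/-- The empty inbox. -/
def empty (lam : ℝ) : Inbox lam := ofFinite ∅ (empty_subset _) finite_empty

@[simp] theorem pts_empty : (empty lam).pts = ∅ := rfl

/-- Arrival of a task with priority `u`; tasks outside of the window are ignored. -/
def insertTask (u : ℝ) (y : Inbox lam) : Inbox lam :=
  ofFinite (y.pts ∪ {u} ∩ Icc (-lam) 0) (union_subset y.pts_subset inter_subset_right)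
    (y.finite.union ((finite_singleton u).subset inter_subset_left))

/-- Execution of the task with the highest priority. -/
def removeMax (y : Inbox lam) : Inbox lam :=
  ofFinite (y.pts \ {q | IsGreatest y.pts q}) (sdiff_subset.trans y.pts_subset)
    (y.finite.subset sdiff_subset)

/-- The effect of a mark `u`: positive marks are executions, all other marks are arrivals of tasks
with priority `u`. -/
noncomputable def act (u : ℝ) (y : Inbox lam) : Inbox lam :=
  if 0 < u then removeMax y else insertTask u y

theorem pts_insertTask (u : ℝ) (y : Inbox lam) :
    (insertTask u y).pts = y.pts ∪ {u} ∩ Icc (-lam) 0 := rfl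

theorem pts_removeMax (y : Inbox lam) :
    (removeMax y).pts = y.pts \ {q | IsGreatest y.pts q} := rfl

theorem insertTask_of_mem {u : ℝ} (hu : u ∈ Icc (-lam) 0) (y : Inbox lam) :
    (insertTask u y).pts = insert u y.pts := by
  rw [pts_insertTask, inter_eq_left.2 (singleton_subset_iff.2 hu), union_singleton]

theorem insertTask_of_notMem {u : ℝ} (hu : u ∉ Icc (-lam) 0) (y : Inbox lam) :
    insertTask u y = y := by
  refine ext_pts ?_
  rw [pts_insertTask, singleton_inter_eq_empty.2 hu, union_empty]

theorem act_of_pos {u : ℝ} (hu : 0 < u) (y : Inbox lam) : act u y = removeMax y := if_pos hu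

theorem act_of_nonpos {u : ℝ} (hu : u ≤ 0) (y : Inbox lam) : act u y = insertTask u y :=
  if_neg hu.not_gt

theorem act_of_lt {u : ℝ} (hlam : 0 ≤ lam) (hu : u < -lam) (y : Inbox lam) : act u y = y := by
  rw [act_of_nonpos (by linarith), insertTask_of_notMem fun h => by linarith [h.1]]

theorem isGreatest_sSup (y : Inbox lam) (h : y.pts.Nonempty) : IsGreatest y.pts (sSup y.pts) :=
  ⟨h.csSup_mem y.finite, fun _ hp => le_csSup y.finite.bddAbove hp⟩

theorem removeMax_eq (y : Inbox lam) : (removeMax y).pts = y.pts \ {sSup y.pts} := by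
  rw [pts_removeMax]
  rcases y.pts.eq_empty_or_nonempty with h | h
  · simp [h]
  · congr 1
    ext q
    exact ⟨fun hq => hq.unique (isGreatest_sSup y h), fun hq => by
      rw [mem_singleton_iff.1 hq]; exact isGreatest_sSup y h⟩

/-- Restriction to a smaller window commutes with the action of a mark. -/
theorem act_restrict {mu : ℝ} (h : Icc (-lam) (0 : ℝ) ⊆ Icc (-mu) 0) (u : ℝ) (y : Inbox mu) :
    (act u y).restrict h = act u (y.restrict h) := by
  refine ext_pts ?_
  rcases lt_or_ge 0 u with hu | hu
  · rw [act_of_pos hu, act_of_pos hu, pts_restrict, pts_removeMax, pts_removeMax, pts_restrict]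
    ext q
    simp only [mem_inter_iff, Set.mem_sdiff, mem_ofPred_eq]
    constructor
    · rintro ⟨⟨hq, hn⟩, hw⟩
      refine ⟨⟨hq, hw⟩, fun hg => hn ⟨hq, fun p hp => ?_⟩⟩
      -- Priorities are at most zero, so a task outside the smaller window lies below it and cannot
      -- compete for the maximum.
      by_cases hpw : p ∈ Icc (-lam) 0
      · exact hg.2 ⟨hp, hpw⟩
      · have := (y.pts_subset hp).2
        have : p < -lam := not_le.1 fun h' => hpw ⟨h', this⟩
        exact this.le.trans hw.1
    · rintro ⟨⟨hq, hw⟩, hn⟩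
      exact ⟨⟨hq, fun hg => hn ⟨⟨hq, hw⟩, fun p hp => hg.2 hp.1⟩⟩, hw⟩
  · rw [act_of_nonpos hu, act_of_nonpos hu, pts_restrict, pts_insertTask, pts_insertTask,
      pts_restrict, union_inter_distrib_right, inter_assoc {u}, inter_eq_right.2 h]

theorem measurable_sSup : Measurable fun y : Inbox lam => sSup y.pts := by
  refine measurable_of_Ioi fun a => ?_
  -- The second set accounts for the default value `sSup ∅ = 0`.
  have : (fun y : Inbox lam => sSup y.pts) ⁻¹' Ioi a =
      {y | y.count (Ioi a) ≠ 0} ∪ {y | y.count univ = 0 ∧ a < 0} := by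
    ext y
    simp only [mem_preimage, mem_Ioi, mem_union, mem_ofPred_eq, count_ne_zero, count_eq_zero,
      mem_univ, not_true_eq_false, imp_false, ← Set.eq_empty_iff_forall_notMem]
    rcases y.pts.eq_empty_or_nonempty with h | h
    · simp [h]
    · simp only [h.ne_empty, false_and, or_false]
      exact ⟨fun ha => ⟨_, (isGreatest_sSup y h).1, ha⟩,
        fun ⟨p, hp, ha⟩ => lt_of_lt_of_le ha ((isGreatest_sSup y h).2 hp)⟩
  rw [this]
  refine MeasurableSet.union ?_ ?_
  · exact (measurable_count measurableSet_Ioi) (measurableSet_singleton 0).compl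
  · exact ((measurable_count MeasurableSet.univ) (measurableSet_singleton 0)).inter
      (MeasurableSet.const _)

theorem measurable_removeMax : Measurable (removeMax : Inbox lam → Inbox lam) := by
  refine measurable_of_count fun B hB => ?_
  classical
  have : (fun y : Inbox lam => (removeMax y).count B) = fun y =>
      if y.count univ ≠ 0 ∧ sSup y.pts ∈ B then y.count B - 1 else y.count B := by
    ext y
    simp only [count, removeMax_eq, inter_univ, Set.encard_ne_zero]
    split_ifs with h
    · rw [← Set.encard_sdiff_singleton_of_mem (show sSup y.pts ∈ y.pts ∩ B from ⟨(isGreatest_sSup y h.1).1, h.2⟩)]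
      congr 1; ext p; simp; tauto
    · congr 1
      ext p
      simp only [mem_inter_iff, Set.mem_sdiff, mem_singleton_iff]
      refine ⟨fun hp => ⟨hp.1.1, hp.2⟩, fun hp => ⟨⟨hp.1, fun he => h ⟨⟨p, hp.1⟩, he ▸ hp.2⟩⟩, hp.2⟩⟩
  rw [this]
  refine Measurable.ite ?_ ?_ (measurable_count hB)
  · exact ((measurable_count MeasurableSet.univ) (measurableSet_singleton 0).compl).inter
      (measurable_sSup hB)
  · exact (measurable_of_countable fun n : ℕ∞ => n - 1).comp (measurable_count hB)

/-- A finite set is closed, so membership can be tested by asking, at every scale `1 / (n + 1)`, for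
a nonzero count in an interval around a nearby rational. This matters for arrivals, since inserting
a task that is already present leaves the counts unchanged. -/
theorem measurableSet_mem : MeasurableSet {p : ℝ × Inbox lam | p.1 ∈ p.2.pts} := by
  have : {p : ℝ × Inbox lam | p.1 ∈ p.2.pts} = ⋂ n : ℕ, ⋃ q : ℚ,
      {p : ℝ × Inbox lam | |p.1 - (q : ℝ)| < 1 / ((n : ℝ) + 1) ∧
        p.2.count (Ioo (q - 1 / ((n : ℝ) + 1)) (q + 1 / ((n : ℝ) + 1))) ≠ 0} := by
    ext ⟨u, y⟩
    simp only [mem_ofPred_eq, mem_iInter, mem_iUnion, count_ne_zero]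
    constructor
    · intro h n
      have hn : (0 : ℝ) < 1 / ((n : ℝ) + 1) := Nat.one_div_pos_of_nat
      obtain ⟨q, hq, hq'⟩ := exists_rat_btwn (show u < u + 1 / ((n : ℝ) + 1) by linarith)
      refine ⟨q, ?_, u, h, ?_, ?_⟩
      · rw [abs_lt]; constructor <;> linarith
      · linarith
      · linarith
    · intro h
      by_contra hu
      obtain ⟨ε, hε, hb⟩ := Metric.isOpen_iff.1 y.finite.isClosed.isOpen_compl u hu
      obtain ⟨n, hn⟩ := exists_nat_one_div_lt (half_pos hε)
      obtain ⟨q, hq, p, hp, hpq⟩ := h n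
      refine hb (show p ∈ Metric.ball u ε from ?_) hp
      rw [Metric.mem_ball, Real.dist_eq, abs_lt]
      rw [abs_lt] at hq
      constructor <;> linarith [hpq.1, hpq.2, hq.1, hq.2]
  rw [this]
  refine MeasurableSet.iInter fun n => MeasurableSet.iUnion fun q => MeasurableSet.inter ?_ ?_
  · exact (continuous_abs.measurable.comp (measurable_fst.sub_const (q : ℝ))) measurableSet_Iio
  · exact ((measurable_count measurableSet_Ioo).comp measurable_snd)
      (measurableSet_singleton 0).compl

theorem measurable_insertTask : Measurable fun p : ℝ × Inbox lam => insertTask p.1 p.2 := by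
  refine measurable_of_count fun B hB => ?_
  classical
  have : (fun p : ℝ × Inbox lam => (insertTask p.1 p.2).count B) = fun p =>
      if (p.1 ∈ Icc (-lam) 0 ∩ B) ∧ p.1 ∉ p.2.pts then p.2.count B + 1 else p.2.count B := by
    ext ⟨u, y⟩
    simp only [count]
    split_ifs with h
    · rw [insertTask_of_mem h.1.1, insert_inter_of_mem h.1.2, encard_insert_of_notMem]
      exact fun h' => h.2 h'.1
    · congr 1
      rw [pts_insertTask]
      ext p
      simp only [mem_inter_iff, mem_union, mem_singleton_iff]
      refine ⟨?_, fun hp => ⟨Or.inl hp.1, hp.2⟩⟩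
      rintro ⟨hp | ⟨rfl, hp⟩, hB⟩
      · exact ⟨hp, hB⟩
      · exact ⟨by_contra fun hn => h ⟨⟨hp, hB⟩, hn⟩, hB⟩
  rw [this]
  refine Measurable.ite (MeasurableSet.inter ?_ measurableSet_mem.compl) ?_ ?_
  · exact measurable_fst (measurableSet_Icc.inter hB)
  · exact (measurable_of_countable fun n : ℕ∞ => n + 1).comp
      ((measurable_count hB).comp measurable_snd)
  · exact (measurable_count hB).comp measurable_snd

theorem measurable_act : Measurable fun p : ℝ × Inbox lam => act p.1 p.2 :=
  Measurable.ite (measurable_fst measurableSet_Ioi) (measurable_removeMax.comp measurable_snd)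
    measurable_insertTask

/-- The number of tasks in the inbox. -/
noncomputable def size (y : Inbox lam) : ℕ := y.pts.ncard

theorem count_univ (y : Inbox lam) : y.count univ = y.size := by
  rw [count, inter_univ, size, y.finite.cast_ncard_eq]

theorem measurable_size : Measurable (size : Inbox lam → ℕ) := by
  have : (size : Inbox lam → ℕ) = fun y => (y.count univ).toNat := by
    ext y; rw [count_univ, ENat.toNat_natCast]
  rw [this]
  exact (measurable_of_countable ENat.toNat).comp (measurable_count MeasurableSet.univ)

theorem size_eq_zero {y : Inbox lam} : y.size = 0 ↔ y = empty lam := by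
  rw [size, ncard_eq_zero y.finite]
  exact ⟨fun h => ext_pts h, fun h => h ▸ rfl⟩

theorem size_removeMax (y : Inbox lam) : (removeMax y).size = y.size - 1 := by
  rcases y.pts.eq_empty_or_nonempty with h | h
  · simp [size, removeMax_eq, h]
  · rw [size, removeMax_eq, ncard_sdiff_singleton_of_mem (isGreatest_sSup y h).1, size]

theorem size_insertTask {u : ℝ} {y : Inbox lam} (hu : u ∈ Icc (-lam) 0) (hy : u ∉ y.pts) :
    (insertTask u y).size = y.size + 1 := by
  rw [size, insertTask_of_mem hu, ncard_insert_of_notMem hy y.finite, size]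

theorem size_insertTask_le {u : ℝ} (y : Inbox lam) :
    (insertTask u y).size ≤ y.size + 1 := by
  by_cases hu : u ∈ Icc (-lam) 0
  · rw [size, insertTask_of_mem hu, size]
    exact ncard_insert_le _ _
  · rw [insertTask_of_notMem hu]; exact Nat.le_succ _

end Inbox

/-! ### The Markov chain driven by i.i.d. marks, forward and backward -/

namespace Inbox

open LocFin

variable {lam : ℝ}

/-- The state of the inbox after the marks `u 0, …, u (m - 1)`, in this order. -/
noncomputable def run : (m : ℕ) → (Fin m → ℝ) → Inbox lam → Inbox lam
  | 0, _, y => y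
  | m + 1, u, y => run m (Fin.tail u) (act (u 0) y)

theorem run_succ (m : ℕ) (u : Fin (m + 1) → ℝ) (y : Inbox lam) :
    run (m + 1) u y = run m (Fin.tail u) (act (u 0) y) := rfl

theorem measurable_run (m : ℕ) :
    Measurable fun p : (Fin m → ℝ) × Inbox lam => run m p.1 p.2 := by
  induction m with
  | zero => exact measurable_snd
  | succ m ih =>
    have h : Measurable fun p : (Fin (m + 1) → ℝ) × Inbox lam =>
        (Fin.tail p.1, act (p.1 0) p.2) := by
      refine Measurable.prodMk ?_ ?_
      · exact measurable_pi_lambda _ fun i => (measurable_pi_apply i.succ).comp measurable_fst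
      · have : Measurable fun p : (Fin (m + 1) → ℝ) × Inbox lam => (p.1 0, p.2) :=
          ((measurable_pi_apply 0).comp measurable_fst).prodMk measurable_snd
        exact measurable_act.comp this
    exact ih.comp h

theorem run_eq_of_forall_act (m : ℕ) (u : ℕ → ℝ) (x : ℕ → Inbox lam)
    (h : ∀ k < m, x (k + 1) = act (u k) (x k)) : x m = run m (fun i => u i) (x 0) := by
  induction m generalizing u x with
  | zero => rfl
  | succ m ih =>
    have := ih (fun k => u (k + 1)) (fun k => x (k + 1)) fun k hk => h (k + 1) (by omega)
    rw [this, h 0 m.succ_pos, run_succ]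
    rfl

/-- The transition operator of the inbox Markov chain whose marks have law `rho`. -/
noncomputable def stepOp (rho : Measure ℝ) (f : Inbox lam → ℝ≥0∞) (y : Inbox lam) : ℝ≥0∞ :=
  ∫⁻ u, f (act u y) ∂rho

theorem measurable_stepOp (rho : Measure ℝ) [SFinite rho] {f : Inbox lam → ℝ≥0∞}
    (hf : Measurable f) : Measurable (stepOp rho f) :=
  Measurable.lintegral_prod_left' (f := fun p : ℝ × Inbox lam => f (act p.1 p.2))
    (hf.comp measurable_act)

theorem measurable_iterate_stepOp (rho : Measure ℝ) [SFinite rho] {f : Inbox lam → ℝ≥0∞}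
    (hf : Measurable f) (m : ℕ) : Measurable ((stepOp rho)^[m] f) := by
  induction m with
  | zero => exact hf
  | succ m ih => rw [Function.iterate_succ_apply']; exact measurable_stepOp rho ih

/-- Induction with Tonelli, splitting off the first mark. This translates between explicit runs and
powers of the transition operator. -/
theorem lintegral_run (rho : Measure ℝ) [SigmaFinite rho] {f : Inbox lam → ℝ≥0∞}
    (hf : Measurable f) (m : ℕ) (y : Inbox lam) :
    ∫⁻ u, f (run m u y) ∂Measure.pi (fun _ : Fin m => rho) = (stepOp rho)^[m] f y := by
  induction m generalizing y with
  | zero => simp [run, lintegral_const]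
  | succ m ih =>
    have h := (measurePreserving_piFinSuccAbove (fun _ : Fin (m + 1) => rho) 0)
    have hm : Measurable fun p : ℝ × (Fin m → ℝ) => f (run m p.2 (act p.1 y)) :=
      hf.comp ((measurable_run m).comp (measurable_snd.prodMk
        (measurable_act.comp (measurable_fst.prodMk measurable_const))))
    rw [Function.iterate_succ_apply', stepOp]
    simp_rw [← ih]
    rw [← lintegral_prod _ hm.aemeasurable, ← h.lintegral_comp hm]
    rfl

/-- The state at the present of the chain started a number of steps in the past from a given
state, where `w i` is the mark of step `i` counted backward in time from the present. -/
noncomputable def back (w : ℕ → ℝ) : ℕ → Inbox lam → Inbox lam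
  | 0, y => y
  | j + 1, y => back w j (act (w j) y)

theorem back_eq_run (w : ℕ → ℝ) (j : ℕ) (y : Inbox lam) :
    back w j y = run j (fun i => w (j - 1 - i)) y := by
  induction j generalizing y with
  | zero => rfl
  | succ j ih =>
    rw [back, ih, run_succ]
    congr 1
    funext i
    simp only [Fin.tail, Fin.val_succ]
    congr 1
    omega

theorem measurable_back (j : ℕ) (y : Inbox lam) :
    Measurable fun w : ℕ → ℝ => back w j y := by
  simp_rw [back_eq_run]
  have : Measurable fun w : ℕ → ℝ => ((fun i : Fin j => w (j - 1 - i)), y) :=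
    (measurable_pi_lambda _ fun i => measurable_pi_apply _).prodMk measurable_const
  exact (measurable_run j).comp this

theorem back_restrict {mu : ℝ} (h : Icc (-lam) (0 : ℝ) ⊆ Icc (-mu) 0) (w : ℕ → ℝ) (j : ℕ)
    (y : Inbox mu) : (back w j y).restrict h = back w j (y.restrict h) := by
  induction j generalizing y with
  | zero => rfl
  | succ j ih => rw [back, ih, act_restrict, back]

/-- Reversing the order of finitely many i.i.d. marks does not change their joint law, so backward
and forward runs have the same law at each fixed number of steps. -/
theorem lintegral_back (rho : Measure ℝ) [IsProbabilityMeasure rho] {f : Inbox lam → ℝ≥0∞}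
    (hf : Measurable f) (j : ℕ) (y : Inbox lam) :
    ∫⁻ w, f (back w j y) ∂Measure.infinitePi (fun _ : ℕ => rho) = (stepOp rho)^[j] f y := by
  have hi : iIndepFun (fun (i : Fin j) (w : ℕ → ℝ) => w (j - 1 - i))
      (Measure.infinitePi fun _ : ℕ => rho) := by
    refine (iIndepFun_infinitePi (P := fun _ : ℕ => rho) (X := fun _ x => x)
      (fun _ => measurable_id)).precomp (g := fun i : Fin j => j - 1 - (i : ℕ)) fun a b hab => ?_
    ext
    simp only at hab
    omega
  have hlaw := (iIndepFun_iff_map_fun_eq_pi_map (fun i => (measurable_pi_apply _).aemeasurable)).1 hi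
  have hm : ∀ i, (Measure.infinitePi fun _ : ℕ => rho).map (fun w => w i) = rho := fun i =>
    Measure.infinitePi_map_eval (μ := fun _ : ℕ => rho) i
  simp_rw [hm] at hlaw
  rw [← lintegral_run rho hf j y, ← hlaw, lintegral_map]
  · simp_rw [back_eq_run]
  · exact hf.comp ((measurable_run j).comp (measurable_id.prodMk measurable_const))
  · exact measurable_pi_lambda _ fun i => measurable_pi_apply _

/-! ### The dominating random walk and coalescence -/

/-- The change of the number of tasks caused by a mark, if the inbox is nonempty. -/
noncomputable def incr (lam u : ℝ) : ℝ := if 0 < u then -1 else if -lam ≤ u then 1 else 0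

theorem size_act_le (hlam : 0 ≤ lam) (u : ℝ) (y : Inbox lam) :
    ((act u y).size : ℝ) ≤ max (y.size + incr lam u) 0 := by
  unfold incr
  split_ifs with h1 h2
  · rw [act_of_pos h1, size_removeMax]
    rcases Nat.eq_zero_or_pos y.size with h | h
    · simp [h]
    · rw [Nat.cast_sub h]; simp
  · rw [act_of_nonpos (not_lt.1 h1)]
    exact le_max_of_le_left (by exact_mod_cast size_insertTask_le y)
  · rw [act_of_lt hlam (not_le.1 h2)]; simp

/-- The random walk that dominates the number of tasks, run backward in time. -/
noncomputable def walk (lam : ℝ) (w : ℕ → ℝ) (j : ℕ) : ℝ := ∑ i ∈ Finset.range j, incr lam (w i)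

theorem measurable_incr (lam : ℝ) : Measurable (incr lam) :=
  Measurable.ite measurableSet_Ioi measurable_const
    (Measurable.ite measurableSet_Ici measurable_const measurable_const)

theorem measurable_walk (lam : ℝ) (j : ℕ) : Measurable fun w => walk lam w j :=
  Finset.measurable_sum _ fun i _ => (measurable_incr lam).comp (measurable_pi_apply i)

/-- At the time where the backward walk attains its maximum, the inbox is empty. -/
theorem back_eq_of_isMax (hlam : 0 ≤ lam) (w : ℕ → ℝ) {i j : ℕ}
    (hmax : ∀ l, walk lam w l ≤ walk lam w i) (hij : i ≤ j) (y : Inbox lam)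
    (hy : y.size + walk lam w j ≤ walk lam w i) : back w j y = back w i (empty lam) := by
  induction j, hij using Nat.le_induction generalizing y with
  | base =>
    have : y.size = 0 := by
      have : (y.size : ℝ) ≤ 0 := by linarith
      exact_mod_cast le_antisymm this (Nat.cast_nonneg _)
    rw [size_eq_zero.1 this]
  | succ j hij ih =>
    rw [back]
    -- The inequality `y.size + walk lam w j ≤ walk lam w i` survives one step: either the size
    -- changes by at most the increment, which the walk compensates, or it is zero, and then
    -- maximality of `walk lam w i` suffices.
    refine ih _ ?_
    have hs : walk lam w (j + 1) = walk lam w j + incr lam (w j) := Finset.sum_range_succ _ _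
    have := size_act_le hlam (w j) y
    rcases le_max_iff.1 this with h | h
    · linarith
    · linarith [hmax j]

/-- The walk starts at zero and stays at or below `-n` from `j` on, so its global maximum is
attained at some `i ≤ j`. Both runs are empty at that `i` and share the remaining marks. -/
theorem back_eq_back_empty (hlam : 0 ≤ lam) (w : ℕ → ℝ) {j k n : ℕ}
    (h : ∀ i, j ≤ i → walk lam w i + n ≤ 0) (hjk : j ≤ k) (y : Inbox lam) (hy : y.size ≤ n) :
    back w j y = back w k (empty lam) := by
  obtain ⟨i, hi, hmax⟩ := Finset.exists_max_image (Finset.range (j + 1)) (walk lam w)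
    ⟨0, by simp⟩
  have h0 : walk lam w 0 = 0 := Finset.sum_range_zero _
  have hmax' : ∀ l, walk lam w l ≤ walk lam w i := fun l => by
    rcases lt_or_ge l (j + 1) with hl | hl
    · exact hmax l (Finset.mem_range.2 hl)
    · have h1 := h l (by omega)
      have h2 := hmax 0 (by simp)
      have : (0 : ℝ) ≤ n := Nat.cast_nonneg n
      linarith
  have hij : i ≤ j := Nat.lt_succ_iff.1 (Finset.mem_range.1 hi)
  have h2 := hmax' 0
  have hy' : (y.size : ℝ) ≤ n := by exact_mod_cast hy
  rw [back_eq_of_isMax hlam w hmax' hij y (by linarith [h j le_rfl]),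
    back_eq_of_isMax hlam w hmax' (hij.trans hjk) (empty lam)]
  have hs : ((empty lam).size : ℝ) = 0 := by simp [size]
  linarith [hmax' k]

/-! ### The mark law and the negative drift -/

/-- The law of the marks of the embedded chain: an execution with probability one half, otherwise
an arrival with uniform priority in `[-1, 0]`. -/
noncomputable def markLaw : Measure ℝ := (2 : ℝ≥0∞)⁻¹ • volume.restrict (Icc (-1) 1)

instance : IsProbabilityMeasure markLaw := ⟨by
  simp only [markLaw, Measure.smul_apply, Measure.restrict_apply MeasurableSet.univ, univ_inter,
    Real.volume_Icc, smul_eq_mul]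
  norm_num
  exact ENNReal.inv_mul_cancel (by simp) (by simp)⟩

theorem lintegral_markLaw (h0 : 0 ≤ lam) (h1 : lam < 1) {f : ℝ → ℝ≥0∞} :
    ∫⁻ u, f u ∂markLaw = 2⁻¹ * ((∫⁻ u in Ico (-1) (-lam), f u) + (∫⁻ u in Icc (-lam) 0, f u) +
      ∫⁻ u in Ioc 0 1, f u) := by
  rw [markLaw, lintegral_smul_measure, smul_eq_mul]
  congr 1
  have hd1 : Disjoint (Ico (-1) (-lam) ∪ Icc (-lam) 0) (Ioc (0 : ℝ) 1) :=
    Set.disjoint_left.2 fun x hx hx' => by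
      rcases hx with hx | hx <;> linarith [hx.2, hx'.1]
  have hd2 : Disjoint (Ico (-1) (-lam)) (Icc (-lam) (0 : ℝ)) :=
    Set.disjoint_left.2 fun x hx hx' => by linarith [hx.2, hx'.1]
  rw [← lintegral_union measurableSet_Icc hd2, ← lintegral_union measurableSet_Ioc hd1,
    Ico_union_Icc_eq_Icc (by linarith) (by linarith), Icc_union_Ioc_eq_Icc (by norm_num)
    (by norm_num)]

/-- The probability space of the stationary chain. -/
noncomputable def markSeqLaw : Measure (ℕ → ℝ) := Measure.infinitePi fun _ => markLaw

instance : IsProbabilityMeasure markSeqLaw := by unfold markSeqLaw; infer_instance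

theorem integral_incr (h0 : 0 ≤ lam) (h1 : lam < 1) :
    ∫ u, incr lam u ∂markLaw = (lam - 1) / 2 := by
  have h : incr lam = fun u => (Icc (-lam) (0 : ℝ)).indicator 1 u - (Ioi (0 : ℝ)).indicator 1 u := by
    ext u
    simp only [incr, indicator, mem_Icc, mem_Ioi, Pi.one_apply]
    grind
  have hi : ∀ s : Set ℝ, MeasurableSet s → Integrable (s.indicator (1 : ℝ → ℝ)) markLaw :=
    fun s hs => (integrable_const (1 : ℝ)).indicator hs
  rw [h, integral_sub (hi _ measurableSet_Icc) (hi _ measurableSet_Ioi),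
    integral_indicator_one measurableSet_Icc, integral_indicator_one measurableSet_Ioi]
  have e1 : Icc (-lam) 0 ∩ Icc (-1 : ℝ) 1 = Icc (-lam) 0 :=
    inter_eq_left.2 (Icc_subset_Icc (by linarith) (by norm_num))
  have e2 : Ioi 0 ∩ Icc (-1 : ℝ) 1 = Ioc 0 1 := by
    ext x; simp only [mem_inter_iff, mem_Ioi, mem_Icc, mem_Ioc]
    exact ⟨fun h => ⟨h.1, h.2.2⟩, fun h => ⟨h.1, by linarith [h.1], h.2⟩⟩
  simp only [markLaw, measureReal_def, Measure.smul_apply, Measure.restrict_apply measurableSet_Icc,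
    Measure.restrict_apply measurableSet_Ioi, e1, e2, Real.volume_Icc, Real.volume_Ioc,
    smul_eq_mul, ENNReal.toReal_mul, ENNReal.toReal_inv, ENNReal.toReal_ofNat]
  rw [ENNReal.toReal_ofReal (by linarith), ENNReal.toReal_ofReal (by norm_num)]
  ring

/-- The strong law of large numbers applies to the increments, whose mean `(lam - 1) / 2` is
negative. This is where subcriticality enters. -/
theorem tendsto_walk (h0 : 0 ≤ lam) (h1 : lam < 1) :
    ∀ᵐ w ∂markSeqLaw, Tendsto (walk lam w) atTop atBot := by
  have hX : iIndepFun (fun i (w : ℕ → ℝ) => incr lam (w i)) markSeqLaw :=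
    iIndepFun_infinitePi (P := fun _ : ℕ => markLaw) (X := fun _ => incr lam)
      (fun _ => measurable_incr lam)
  have hm : ∀ i, markSeqLaw.map (fun w : ℕ → ℝ => w i) = markLaw := fun i =>
    Measure.infinitePi_map_eval (μ := fun _ : ℕ => markLaw) i
  have hid : ∀ i, IdentDistrib (fun w : ℕ → ℝ => incr lam (w i)) (fun w => incr lam (w 0))
      markSeqLaw markSeqLaw := fun i =>
    (IdentDistrib.mk (measurable_pi_apply i).aemeasurable (measurable_pi_apply 0).aemeasurable
      ((hm i).trans (hm 0).symm)).comp
      (measurable_incr lam)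
  have hint : Integrable (fun w : ℕ → ℝ => incr lam (w 0)) markSeqLaw := by
    refine Integrable.of_bound (C := 1)
      ((measurable_incr lam).comp (measurable_pi_apply 0)).aestronglyMeasurable
      (ae_of_all _ fun w => ?_)
    unfold incr; split_ifs <;> simp
  have hexp : ∫ w, incr lam (w 0) ∂markSeqLaw = (lam - 1) / 2 := by
    rw [← integral_incr h0 h1, ← hm 0, integral_map (measurable_pi_apply 0).aemeasurable
      (measurable_incr lam).aestronglyMeasurable]
  filter_upwards [strong_law_ae_real _ hint (fun i j hij => hX.indepFun hij) hid] with w hw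
  rw [hexp] at hw
  have := hw.neg_mul_atTop (by linarith) (tendsto_natCast_atTop_atTop (R := ℝ))
  refine this.congr' ?_
  filter_upwards [eventually_gt_atTop 0] with n hn
  rw [div_mul_cancel₀]
  · rfl
  · positivity

end Inbox

/-- In a countable space with measurable singletons every set is Borel. The instance makes suprema
and lower limits of counts measurable. -/
instance ENat.instBorelSpace : BorelSpace ℕ∞ := by
  refine ⟨le_antisymm (fun s _ => ?_) le_top⟩
  have h : @BorelSpace ℕ∞ _ (borel ℕ∞) := @BorelSpace.mk _ _ (borel ℕ∞) rfl
  exact @Set.Countable.measurableSet ℕ∞ (borel ℕ∞)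
    (@OpensMeasurableSpace.toMeasurableSingletonClass ℕ∞ _ (borel ℕ∞) _ _) s s.to_countable

/-! ### Coupling from the past and the stationary inbox -/

namespace Inbox

open LocFin

variable {lam : ℝ}

theorem incr_mono {mu : ℝ} (h : lam ≤ mu) (u : ℝ) : incr lam u ≤ incr mu u := by
  unfold incr
  grind

theorem walk_mono {mu : ℝ} (h : lam ≤ mu) (w : ℕ → ℝ) (j : ℕ) : walk lam w j ≤ walk mu w j :=
  Finset.sum_le_sum fun _ _ => incr_mono h _

/-- The probability that the backward walk exceeds `-n` at some time after `j`. -/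
noncomputable def exceedProb (lam : ℝ) (j n : ℕ) : ℝ≥0∞ :=
  markSeqLaw {w | ∃ i, j ≤ i ∧ 0 < walk lam w i + n}

theorem measurableSet_exceed (lam : ℝ) (j n : ℕ) :
    MeasurableSet {w | ∃ i, j ≤ i ∧ 0 < walk lam w i + n} := by
  simp only [ofPred_exists, ofPred_and]
  refine MeasurableSet.iUnion fun i => (MeasurableSet.const _).inter ?_
  exact measurableSet_lt measurable_const ((measurable_walk lam i).add_const _)

theorem exceedProb_le_one (lam : ℝ) (j n : ℕ) : exceedProb lam j n ≤ 1 := prob_le_one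

theorem exceedProb_anti (lam : ℝ) (n : ℕ) : Antitone fun j => exceedProb lam j n :=
  fun _ _ h => measure_mono fun _ ⟨i, hi, hw⟩ => ⟨i, h.trans hi, hw⟩

/-- The events decrease in `j`, and on their intersection the walk does not tend to `-∞`, which has
probability zero. -/
theorem tendsto_exceedProb (h0 : 0 ≤ lam) (h1 : lam < 1) (n : ℕ) :
    Tendsto (fun j => exceedProb lam j n) atTop (𝓝 0) := by
  have h := tendsto_measure_iInter_atTop (μ := markSeqLaw)
    (s := fun j => {w | ∃ i, j ≤ i ∧ 0 < walk lam w i + n})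
    (fun j => (measurableSet_exceed lam j n).nullMeasurableSet)
    (fun _ _ h _ ⟨i, hi, hw⟩ => ⟨i, h.trans hi, hw⟩) ⟨0, measure_ne_top _ _⟩
  have hz : markSeqLaw (⋂ j, {w | ∃ i, j ≤ i ∧ 0 < walk lam w i + n}) = 0 := by
    refine measure_mono_null (t := {w | Tendsto (walk lam w) atTop atBot}ᶜ) (fun w hw ht => ?_)
      (tendsto_walk h0 h1)
    obtain ⟨j, hj⟩ := eventually_atTop.1 (ht.eventually_le_atBot (-n : ℝ))
    obtain ⟨i, hi, hwi⟩ := mem_iInter.1 hw j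
    linarith [hj i hi]
  rwa [hz] at h

/-- A sequence of windows `[-lam, 0]` that exhausts `(-1, 0]`. -/
noncomputable def lamSeq (k : ℕ) : ℝ := 1 - 1 / ((k : ℝ) + 1)

theorem lamSeq_nonneg (k : ℕ) : 0 ≤ lamSeq k := by
  have : 1 / ((k : ℝ) + 1) ≤ 1 := by
    rw [div_le_one (by positivity)]; linarith [(Nat.cast_nonneg k : (0 : ℝ) ≤ k)]
  unfold lamSeq; linarith

theorem lamSeq_lt_one (k : ℕ) : lamSeq k < 1 := by
  have : 0 < 1 / ((k : ℝ) + 1) := Nat.one_div_pos_of_nat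
  unfold lamSeq; linarith

theorem exists_lamSeq_ge (h1 : lam < 1) : ∃ k, lam ≤ lamSeq k := by
  obtain ⟨k, hk⟩ := exists_nat_one_div_lt (sub_pos.2 h1)
  exact ⟨k, by unfold lamSeq; linarith⟩

/-- A measurable set of full measure on which all backward walks diverge. -/
def goodSet : Set (ℕ → ℝ) :=
  (toMeasurable markSeqLaw {w | ∀ k, Tendsto (walk (lamSeq k) w) atTop atBot}ᶜ)ᶜ

theorem measurableSet_goodSet : MeasurableSet goodSet := (measurableSet_toMeasurable _ _).compl

theorem ae_mem_goodSet : ∀ᵐ w ∂markSeqLaw, w ∈ goodSet := by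
  have h : ∀ᵐ w ∂markSeqLaw, ∀ k, Tendsto (walk (lamSeq k) w) atTop atBot :=
    ae_all_iff.2 fun k => tendsto_walk (lamSeq_nonneg k) (lamSeq_lt_one k)
  rw [ae_iff] at h ⊢
  have e : {w | w ∉ goodSet} =
      toMeasurable markSeqLaw {w | ∀ k, Tendsto (walk (lamSeq k) w) atTop atBot}ᶜ := compl_compl _
  rw [e, measure_toMeasurable]
  exact h

theorem tendsto_walk_of_mem {w : ℕ → ℝ} (hw : w ∈ goodSet) (h1 : lam < 1) :
    Tendsto (walk lam w) atTop atBot := by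
  obtain ⟨k, hk⟩ := exists_lamSeq_ge h1
  have : ∀ k, Tendsto (walk (lamSeq k) w) atTop atBot := by
    by_contra h
    exact hw (subset_toMeasurable _ _ h)
  exact tendsto_atBot_mono (walk_mono hk w) (this k)

/-- The tasks that are eventually present in the inbox started empty in the remote past. -/
def limitPts (w : ℕ → ℝ) : Set ℝ :=
  {p | w ∈ goodSet ∧ p ∈ Ioc (-1) 0 ∧ ∀ᶠ n in atTop, p ∈ (back w n (empty 1)).pts}

/-- Restriction to a window commutes with `back`, and the runs from the empty inbox in `[-lam, 0]`
agree for all starting times from `j` on. Inside the window the eventual membership is thus decided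
at `j`. -/
theorem limitPts_inter (h0 : 0 ≤ lam) (h1 : lam < 1) {w : ℕ → ℝ} (hw : w ∈ goodSet) {j : ℕ}
    (hj : ∀ i, j ≤ i → walk lam w i ≤ 0) :
    limitPts w ∩ Icc (-lam) 0 = (back w j (empty lam)).pts := by
  have hsub : Icc (-lam) (0 : ℝ) ⊆ Icc (-1) 0 := Icc_subset_Icc (by linarith) le_rfl
  have hr : ∀ n, (back w n (empty 1)).pts ∩ Icc (-lam) 0 = (back w n (empty lam)).pts := by
    intro n
    rw [← pts_restrict hsub, back_restrict]
    congr 2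
    exact ext_pts (by simp)
  have hc : ∀ n, j ≤ n → back w j (empty lam) = back w n (empty lam) := fun n hn =>
    back_eq_back_empty h0 w (n := 0) (by simpa using hj) hn _ (by simp [size])
  ext p
  constructor
  · rintro ⟨⟨-, -, hp⟩, hpw⟩
    obtain ⟨n, hn, hpn⟩ := ((eventually_ge_atTop j).and hp).exists
    rw [hc n hn, ← hr]
    exact ⟨hpn, hpw⟩
  · intro hp
    have hpw := (back w j (empty lam)).pts_subset hp
    refine ⟨⟨hw, window_subset h1 hpw, ?_⟩, hpw⟩
    filter_upwards [eventually_ge_atTop j] with n hn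
    rw [hc n hn, ← hr] at hp
    exact hp.1

theorem exists_window_of_isCompact {K : Set ℝ} (hK : IsCompact K) (h : K ⊆ Ioc (-1) 0) :
    ∃ k, K ⊆ Icc (-lamSeq k) 0 := by
  rcases K.eq_empty_or_nonempty with rfl | hne
  · exact ⟨0, empty_subset _⟩
  · obtain ⟨m, hm, hmin⟩ := hK.exists_isLeast hne
    obtain ⟨k, hk⟩ := exists_lamSeq_ge (lam := -m) (by linarith [(h hm).1])
    exact ⟨k, fun p hp => ⟨by linarith [hmin hp], (h hp).2⟩⟩

/-- The stationary inbox, obtained by coupling from the past. -/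
def stationary (w : ℕ → ℝ) : LocFin (Ioc (-1 : ℝ) 0) :=
  ⟨limitPts w, fun _ hp => hp.2.1, fun K hK hc => by
    obtain ⟨k, hk⟩ := exists_window_of_isCompact hc hK
    -- Off `goodSet` the set of points is empty by definition, so local finiteness holds for every
    -- `w` and not only almost surely.
    by_cases hw : w ∈ goodSet
    · obtain ⟨j, hj⟩ := eventually_atTop.1
        ((tendsto_walk_of_mem hw (lamSeq_lt_one k)).eventually_le_atBot 0)
      refine Set.Finite.subset ?_ (inter_subset_inter_right _ hk)
      rw [limitPts_inter (lamSeq_nonneg k) (lamSeq_lt_one k) hw hj]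
      exact finite _
    · refine Set.finite_empty.subset fun p hp => hw hp.1.1⟩

theorem pts_stationary (w : ℕ → ℝ) : (stationary w).pts = limitPts w := rfl

theorem stationary_restrict (h0 : 0 ≤ lam) (h1 : lam < 1) {w : ℕ → ℝ} (hw : w ∈ goodSet) {j : ℕ}
    (hj : ∀ i, j ≤ i → walk lam w i ≤ 0) :
    (stationary w).restrict (window_subset h1) = back w j (empty lam) :=
  ext_pts (by rw [pts_restrict, pts_stationary, limitPts_inter h0 h1 hw hj])

theorem eventually_stationary_restrict (h0 : 0 ≤ lam) (h1 : lam < 1) {w : ℕ → ℝ}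
    (hw : w ∈ goodSet) :
    ∀ᶠ n in atTop, back w n (empty lam) = (stationary w).restrict (window_subset h1) := by
  obtain ⟨j, hj⟩ := eventually_atTop.1
    ((tendsto_walk_of_mem hw h1).eventually_le_atBot 0)
  filter_upwards [eventually_ge_atTop j] with n hn
  rw [stationary_restrict h0 h1 hw fun i hi => hj i (hn.trans hi)]

theorem back_eq_stationary (h0 : 0 ≤ lam) (h1 : lam < 1) {w : ℕ → ℝ} (hw : w ∈ goodSet) {j : ℕ}
    (y : Inbox lam) (hj : ∀ i, j ≤ i → walk lam w i + y.size ≤ 0) :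
    back w j y = (stationary w).restrict (window_subset h1) := by
  have hs : (0 : ℝ) ≤ y.size := Nat.cast_nonneg _
  rw [stationary_restrict h0 h1 hw fun i hi => by linarith [hj i hi],
    back_eq_back_empty h0 w hj le_rfl y le_rfl]

/-- Every finite subset of `(-1, 0]` fits into some window, so even an infinite count is exhausted
by the windows. -/
theorem count_eq_iSup (y : LocFin (Ioc (-1 : ℝ) 0)) (B : Set ℝ) :
    y.count B = ⨆ k, (y.restrict (window_subset (lamSeq_lt_one k))).count B := by
  refine le_antisymm (ENat.forall_natCast_le_iff_le.1 fun n hn => ?_) (iSup_le fun k => ?_)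
  · obtain ⟨t, ht, htn⟩ := exists_subset_encard_eq hn
    have hf : t.Finite := finite_of_encard_eq_coe htn
    obtain ⟨k, hk⟩ := exists_window_of_isCompact hf.isCompact
      ((ht.trans inter_subset_left).trans y.pts_subset)
    refine le_iSup_of_le k ?_
    rw [← htn]
    exact encard_le_encard fun p hp => ⟨⟨(ht hp).1, hk hp⟩, (ht hp).2⟩
  · rw [count_restrict]
    exact encard_le_encard (inter_subset_inter_right _ inter_subset_right)

theorem measurable_stationary : Measurable stationary := by
  refine measurable_of_count fun B hB => ?_
  simp_rw [count_eq_iSup]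
  refine Measurable.iSup fun k => ?_
  -- On `goodSet` the sequence of windowed states is eventually constant, hence its counts have this
  -- value as lower limit; off `goodSet` both sides vanish.
  have : (fun w => ((stationary w).restrict (window_subset (lamSeq_lt_one k))).count B) =
      goodSet.indicator fun w =>
        liminf (fun n => (back w n (empty (lamSeq k))).count B) atTop := by
    ext w
    by_cases hw : w ∈ goodSet
    · rw [indicator_of_mem hw]
      refine (Tendsto.liminf_eq ?_).symm
      refine tendsto_const_nhds.congr' ?_
      filter_upwards [eventually_stationary_restrict (lamSeq_nonneg k) (lamSeq_lt_one k) hw]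
        with n hn
      rw [hn]
    · rw [indicator_of_notMem hw, count_eq_zero]
      exact fun p hp _ => hw hp.1.1
  rw [this]
  refine Measurable.indicator ?_ measurableSet_goodSet
  exact Measurable.liminf fun n => (measurable_count hB).comp (measurable_back n _)

/-- The stationary inbox restricted to the window `[-lam, 0]`. -/
def stationaryWindow (h1 : lam < 1) (w : ℕ → ℝ) : Inbox lam :=
  (stationary w).restrict (window_subset h1)

theorem measurable_stationaryWindow (h1 : lam < 1) : Measurable (stationaryWindow h1) :=
  (LocFin.measurable_restrict _ measurableSet_Icc).comp measurable_stationary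

/-! ### Convergence and invariance for the embedded chain -/

/-- The embedded chain converges to the stationary inbox, uniformly in total variation for
initial states of bounded size. -/
theorem iterate_stepOp_indicator_le (h0 : 0 ≤ lam) (h1 : lam < 1) {A : Set (Inbox lam)}
    (hA : MeasurableSet A) (j : ℕ) (y : Inbox lam) :
    (stepOp markLaw)^[j] (A.indicator 1) y ≤
      markSeqLaw (stationaryWindow h1 ⁻¹' A) + exceedProb lam j y.size := by
  rw [← lintegral_back markLaw (measurable_one.indicator hA)]
  have : ∀ w, A.indicator (1 : Inbox lam → ℝ≥0∞) (back w j y) =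
      ((fun w => back w j y) ⁻¹' A).indicator 1 w := fun w => rfl
  simp_rw [this]
  rw [lintegral_indicator_one (measurable_back j y hA)]
  refine (measure_mono_ae (t := stationaryWindow h1 ⁻¹' A ∪
    {w | ∃ i, j ≤ i ∧ 0 < walk lam w i + y.size}) ?_).trans (measure_union_le _ _)
  change ∀ᵐ w ∂markSeqLaw, _
  filter_upwards [ae_mem_goodSet] with w hw hwA
  -- Outside this event coalescence has occurred, and the two states are equal rather than merely
  -- close.
  by_cases he : ∃ i, j ≤ i ∧ 0 < walk lam w i + y.size
  · exact Or.inr he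
  · push Not at he
    left
    change stationaryWindow h1 w ∈ A
    rw [stationaryWindow, ← back_eq_stationary h0 h1 hw y he]
    exact hwA

theorem stepOp_le_one (rho : Measure ℝ) [IsProbabilityMeasure rho] {f : Inbox lam → ℝ≥0∞}
    (hf : ∀ y, f y ≤ 1) (y : Inbox lam) : stepOp rho f y ≤ 1 :=
  (lintegral_mono fun _ => hf _).trans (by simp)

theorem tendsto_iterate_stepOp (h0 : 0 ≤ lam) (h1 : lam < 1) {f : Inbox lam → ℝ≥0∞}
    (hf : Measurable f) (hf1 : ∀ y, f y ≤ 1) :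
    Tendsto (fun j => (stepOp markLaw)^[j] f (empty lam)) atTop
      (𝓝 (∫⁻ w, f (stationaryWindow h1 w) ∂markSeqLaw)) := by
  simp_rw [← lintegral_back markLaw hf]
  refine tendsto_lintegral_of_dominated_convergence (fun _ => 1)
    (fun n => hf.comp (measurable_back n _)) (fun n => ae_of_all _ fun w => hf1 _) ?_ ?_
  · rw [lintegral_const, measure_univ]; simp
  · change ∀ᵐ w ∂markSeqLaw, _
    filter_upwards [ae_mem_goodSet] with w hw
    refine tendsto_const_nhds.congr' ?_
    filter_upwards [eventually_stationary_restrict h0 h1 hw] with n hn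
    rw [hn, stationaryWindow]

/-- Both sides are limits of the same sequence of iterates started from the empty inbox, shifted by
one step. -/
theorem lintegral_stepOp_stationary (h0 : 0 ≤ lam) (h1 : lam < 1) {f : Inbox lam → ℝ≥0∞}
    (hf : Measurable f) (hf1 : ∀ y, f y ≤ 1) :
    ∫⁻ w, stepOp markLaw f (stationaryWindow h1 w) ∂markSeqLaw =
      ∫⁻ w, f (stationaryWindow h1 w) ∂markSeqLaw := by
  refine tendsto_nhds_unique
    (tendsto_iterate_stepOp h0 h1 (measurable_stepOp markLaw hf) (stepOp_le_one markLaw hf1)) ?_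
  refine ((tendsto_iterate_stepOp h0 h1 hf hf1).comp (tendsto_add_atTop_nat 1)).congr fun j => ?_
  rw [Function.comp, Function.iterate_succ_apply]

theorem stepOp_markLaw (h0 : 0 ≤ lam) (h1 : lam < 1) (f : Inbox lam → ℝ≥0∞) (y : Inbox lam) :
    stepOp markLaw f y = 2⁻¹ * (ENNReal.ofReal (1 - lam) * f y +
      (∫⁻ u in Icc (-lam) 0, f (insertTask u y)) + f (removeMax y)) := by
  rw [stepOp, lintegral_markLaw h0 h1]
  congr 3
  · rw [setLIntegral_congr_fun (g := fun _ => f y) measurableSet_Ico fun u hu => by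
      rw [act_of_lt h0 hu.2], setLIntegral_const, Real.volume_Ico, mul_comm]
    congr 2; ring
  · exact setLIntegral_congr_fun measurableSet_Icc fun u hu => by rw [act_of_nonpos hu.2]
  · rw [setLIntegral_congr_fun (g := fun _ => f (removeMax y)) measurableSet_Ioc fun u hu => by
      rw [act_of_pos hu.1], setLIntegral_const, Real.volume_Ioc]
    simp

/-! ### The geometric law of the size and the infinite number of tasks -/

/-- The probability that the stationary inbox has a given number of tasks. -/
noncomputable def sizeProb (h1 : lam < 1) (n : ℕ) : ℝ :=
  markSeqLaw.real {w | (stationaryWindow h1 w).size = n}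

theorem stepOp_indicator_size (h0 : 0 ≤ lam) (h1 : lam < 1) (n : ℕ) (y : Inbox lam) :
    stepOp markLaw ({y : Inbox lam | n < y.size}.indicator 1) y =
      2⁻¹ * (ENNReal.ofReal (1 - lam) * {y : Inbox lam | n < y.size}.indicator 1 y +
        ENNReal.ofReal lam * {y : Inbox lam | n ≤ y.size}.indicator 1 y +
        {y : Inbox lam | n + 1 < y.size}.indicator 1 y) := by
  classical
  rw [stepOp_markLaw h0 h1]
  congr 2
  · congr 1
    -- Almost every arriving priority is new, so an arrival raises the size by exactly one.
    have hnull : ∀ᵐ u ∂(volume : Measure ℝ), u ∉ y.pts :=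
      (measure_eq_zero_iff_ae_notMem).1 (y.finite.measure_zero volume)
    rw [setLIntegral_congr_fun_ae (g := fun _ => {y : Inbox lam | n ≤ y.size}.indicator 1 y)
      measurableSet_Icc (by
        filter_upwards [hnull] with u hu huw
        simp only [indicator_apply, mem_ofPred_eq, size_insertTask huw hu, Nat.lt_succ_iff, Pi.one_apply])]
    rw [setLIntegral_const, Real.volume_Icc, mul_comm]
    simp
  · simp only [indicator_apply, mem_ofPred_eq, size_removeMax, Nat.lt_sub_iff_add_lt, Pi.one_apply]

/-- Invariance on the event that the size exceeds `n` is a balance of flows between `n` and `n + 1`: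
upward `lam / 2 * sizeProb h1 n`, downward `sizeProb h1 (n + 1) / 2`. -/
theorem sizeProb_succ (h0 : 0 ≤ lam) (h1 : lam < 1) (n : ℕ) :
    sizeProb h1 (n + 1) = lam * sizeProb h1 n := by
  have hms : Measurable fun w => (stationaryWindow h1 w).size :=
    measurable_size.comp (measurable_stationaryWindow h1)
  have hS : ∀ (s : Set ℕ), MeasurableSet {w | (stationaryWindow h1 w).size ∈ s} := fun s =>
    hms (MeasurableSet.of_discrete (s := s))
  have hS' : ∀ (s : Set ℕ), MeasurableSet {y : Inbox lam | y.size ∈ s} := fun s =>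
    measurable_size (MeasurableSet.of_discrete (s := s))
  have hind : ∀ (s : Set ℕ), ∫⁻ w, {y : Inbox lam | y.size ∈ s}.indicator 1 (stationaryWindow h1 w)
      ∂markSeqLaw = markSeqLaw {w | (stationaryWindow h1 w).size ∈ s} := fun s =>
    lintegral_indicator_one (hS s)
  have hmi : ∀ (s : Set ℕ), Measurable fun w =>
      {y : Inbox lam | y.size ∈ s}.indicator (1 : Inbox lam → ℝ≥0∞) (stationaryWindow h1 w) :=
    fun s => (measurable_one.indicator (hS' s)).comp (measurable_stationaryWindow h1)
  have hinv := lintegral_stepOp_stationary h0 h1 (measurable_one.indicator (hS' (Ioi n)))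
    (fun y => indicator_le_self' (fun _ _ => zero_le_one) y)
  have hstep := stepOp_indicator_size h0 h1 n
  change ∀ y, stepOp markLaw ({y : Inbox lam | y.size ∈ Ioi n}.indicator 1) y = 2⁻¹ *
    (ENNReal.ofReal (1 - lam) * {y : Inbox lam | y.size ∈ Ioi n}.indicator 1 y +
      ENNReal.ofReal lam * {y : Inbox lam | y.size ∈ Ici n}.indicator 1 y +
      {y : Inbox lam | y.size ∈ Ioi (n + 1)}.indicator 1 y) at hstep
  simp_rw [hstep] at hinv
  rw [lintegral_const_mul _ (by fun_prop), lintegral_add_left (by fun_prop),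
    lintegral_add_left (by fun_prop), lintegral_const_mul _ (by fun_prop),
    lintegral_const_mul _ (by fun_prop), hind, hind, hind] at hinv
  have hreal := congrArg ENNReal.toReal hinv
  rw [ENNReal.toReal_mul, ENNReal.toReal_add (by finiteness) (by finiteness),
    ENNReal.toReal_add (by finiteness) (by finiteness), ENNReal.toReal_mul, ENNReal.toReal_mul,
    ENNReal.toReal_ofReal (by linarith), ENNReal.toReal_ofReal h0, ENNReal.toReal_inv,
    ENNReal.toReal_ofNat] at hreal
  simp only [← measureReal_def] at hreal
  have hsplit : ∀ m, markSeqLaw.real {w | (stationaryWindow h1 w).size ∈ Ici m} =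
      markSeqLaw.real {w | (stationaryWindow h1 w).size ∈ Ioi m} + sizeProb h1 m := by
    intro m
    have hd : Disjoint {w | (stationaryWindow h1 w).size ∈ Ioi m}
        {w | (stationaryWindow h1 w).size = m} := Set.disjoint_left.2 fun w hw hw' => by
      simp only [mem_ofPred_eq, mem_Ioi] at hw hw'
      omega
    rw [sizeProb, ← measureReal_union (μ := markSeqLaw) hd (hms (measurableSet_singleton m))]
    congr 1
    ext w
    simp [le_iff_lt_or_eq, eq_comm]
  have e1 : Ioi n = Ici (n + 1) := rfl
  rw [hsplit n, e1, hsplit (n + 1)] at hreal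
  linarith

theorem sizeProb_eq (h0 : 0 ≤ lam) (h1 : lam < 1) (n : ℕ) :
    sizeProb h1 n = (1 - lam) * lam ^ n := by
  have hg : ∀ n, sizeProb h1 n = sizeProb h1 0 * lam ^ n := fun n => by
    induction n with
    | zero => simp
    | succ n ih => rw [sizeProb_succ h0 h1, ih, pow_succ]; ring
  have hms : Measurable fun w => (stationaryWindow h1 w).size :=
    measurable_size.comp (measurable_stationaryWindow h1)
  have hsum : HasSum (fun n => sizeProb h1 n) 1 := by
    have hu : ⋃ n, {w | (stationaryWindow h1 w).size = n} = univ := by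
      ext w; simp
    have h := measure_iUnion (μ := markSeqLaw)
      (f := fun n => {w | (stationaryWindow h1 w).size = n})
      (fun i j hij => Set.disjoint_left.2 fun w hw hw' => hij (hw.symm.trans hw'))
      (fun i => hms (measurableSet_singleton i))
    rw [hu, measure_univ] at h
    have h' := ENNReal.hasSum_toReal (h ▸ ENNReal.one_ne_top)
    rwa [← ENNReal.tsum_toReal_eq (fun _ => measure_ne_top _ _), ← h, ENNReal.toReal_one] at h'
  have hsum' : HasSum (fun n => sizeProb h1 0 * lam ^ n) (sizeProb h1 0 * (1 - lam)⁻¹) :=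
    (hasSum_geometric_of_lt_one h0 h1).mul_left _
  simp_rw [← hg] at hsum'
  have h := hsum.unique hsum'
  have h2 : sizeProb h1 0 = 1 - lam := by
    field_simp [(sub_pos.2 h1).ne'] at h
    linarith
  rw [hg, h2]

theorem count_stationary (h1 : lam < 1) (w : ℕ → ℝ) :
    (stationary w).count (Icc (-lam) 0) = (stationaryWindow h1 w).size := by
  rw [← count_univ, stationaryWindow, count_restrict, inter_univ]

theorem measure_count_stationary (h0 : 0 ≤ lam) (h1 : lam < 1) (n : ℕ) :
    markSeqLaw.real {w | (stationary w).count (Icc (-lam) 0) = n} = (1 - lam) * lam ^ n := by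
  rw [← sizeProb_eq h0 h1, sizeProb]
  simp_rw [count_stationary h1, Nat.cast_inj]

theorem measureReal_size_le_le (h0 : 0 ≤ lam) (h1 : lam < 1) (n : ℕ) :
    markSeqLaw.real {w | (stationaryWindow h1 w).size ≤ n} ≤ (n + 1) * (1 - lam) := by
  have hu : {w | (stationaryWindow h1 w).size ≤ n} =
      ⋃ i ∈ Finset.range (n + 1), {w | (stationaryWindow h1 w).size = i} := by
    ext w; simp
  rw [hu]
  refine (measureReal_biUnion_finset_le _ _).trans ?_
  have : ∀ i ∈ Finset.range (n + 1), markSeqLaw.real {w | (stationaryWindow h1 w).size = i} ≤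
      1 - lam := fun i _ => by
    change sizeProb h1 i ≤ _
    rw [sizeProb_eq h0 h1]
    exact mul_le_of_le_one_right (by linarith) (pow_le_one₀ h0 h1.le)
  refine (Finset.sum_le_card_nsmul _ _ _ this).trans (le_of_eq ?_)
  simp

/-- If there are `n` points in all, then every window holds at most `n`. Each of the values `0, …,
n` has probability at most `1 - lam` in the window `[-lam, 0]`, and `lam` may approach one. -/
theorem ae_infinite_stationary : ∀ᵐ w ∂markSeqLaw, (stationary w).pts.Infinite := by
  have key : ∀ n : ℕ, markSeqLaw.real {w | (stationary w).pts.encard = n} = 0 := by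
    intro n
    have hle : ∀ k : ℕ, markSeqLaw.real {w | (stationary w).pts.encard = n} ≤
        (n + 1) * (1 / ((k : ℝ) + 1)) := fun k => by
      have h := measureReal_size_le_le (lamSeq_nonneg k) (lamSeq_lt_one k) n
      rw [show 1 - lamSeq k = 1 / ((k : ℝ) + 1) by unfold lamSeq; ring] at h
      refine (measureReal_mono fun w hw => ?_).trans h
      have hw' : (stationary w).pts.encard = n := hw
      have : ((stationaryWindow (lamSeq_lt_one k) w).size : ℕ∞) ≤ n := by
        rw [← count_stationary, count, ← hw']
        exact encard_le_encard inter_subset_left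
      exact_mod_cast this
    have ht : Tendsto (fun k : ℕ => ((n : ℝ) + 1) * (1 / ((k : ℝ) + 1))) atTop (𝓝 0) := by
      simpa using (tendsto_one_div_add_atTop_nhds_zero_nat (𝕜 := ℝ)).const_mul ((n : ℝ) + 1)
    exact le_antisymm (ge_of_tendsto' ht hle) measureReal_nonneg
  have h : ∀ᵐ w ∂markSeqLaw, ∀ n : ℕ, (stationary w).pts.encard ≠ n := by
    refine ae_all_iff.2 fun n => ?_
    rw [ae_iff]
    simpa [measureReal_eq_zero_iff] using key n
  filter_upwards [h] with w hw hf
  exact hw _ hf.cast_ncard_eq.symm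

end Inbox

/-! ### Independence of families of pairs -/

section Independence

variable {Ω ι α β : Type*} [MeasurableSpace Ω] [MeasurableSpace α] [MeasurableSpace β]
  {P : Measure Ω} [IsProbabilityMeasure P]

/-- The joint law is a product of two product measures; regrouping the factors index by index makes
it the product of the laws of the pairs. -/
theorem ProbabilityTheory.iIndepFun.prodMk_of_indepFun [Fintype ι] {X : ι → Ω → α}
    {Z : ι → Ω → β} (hX : iIndepFun X P) (hZ : iIndepFun Z P) (mX : ∀ i, Measurable (X i))
    (mZ : ∀ i, Measurable (Z i)) (h : IndepFun (fun ω i => X i ω) (fun ω i => Z i ω) P) :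
    iIndepFun (fun i ω => (X i ω, Z i ω)) P := by
  have mX' := measurable_pi_lambda (fun ω i => X i ω) mX
  have mZ' := measurable_pi_lambda (fun ω i => Z i ω) mZ
  rw [iIndepFun_iff_map_fun_eq_pi_map fun i => ((mX i).prodMk (mZ i)).aemeasurable]
  have : ∀ i, IsProbabilityMeasure (P.map (X i)) := fun i =>
    Measure.isProbabilityMeasure_map (mX i).aemeasurable
  have : ∀ i, IsProbabilityMeasure (P.map (Z i)) := fun i =>
    Measure.isProbabilityMeasure_map (mZ i).aemeasurable
  have hpair : ∀ i, P.map (fun ω => (X i ω, Z i ω)) = (P.map (X i)).prod (P.map (Z i)) := fun i =>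
    (indepFun_iff_map_prod_eq_prod_map_map (mX i).aemeasurable (mZ i).aemeasurable).1
      (h.comp (measurable_pi_apply i) (measurable_pi_apply i))
  have hjoint := (indepFun_iff_map_prod_eq_prod_map_map mX'.aemeasurable mZ'.aemeasurable).1 h
  rw [(iIndepFun_iff_map_fun_eq_pi_map fun i => (mX i).aemeasurable).1 hX,
    (iIndepFun_iff_map_fun_eq_pi_map fun i => (mZ i).aemeasurable).1 hZ] at hjoint
  have hp := (measurePreserving_arrowProdEquivProdArrow α β ι (fun i => P.map (X i))
    (fun i => P.map (Z i))).symm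
  simp_rw [hpair]
  rw [← hp.map_eq, ← hjoint, Measure.map_map hp.measurable (mX'.prodMk mZ')]
  rfl

theorem ProbabilityTheory.iIndepFun.prodMk_of_sum [Fintype ι] {X Z : ι → Ω → α}
    (mX : ∀ i, Measurable (X i)) (mZ : ∀ i, Measurable (Z i)) (h : iIndepFun (Sum.elim X Z) P) :
    iIndepFun (fun i ω => (X i ω, Z i ω)) P := by
  classical
  have hX : iIndepFun X P := h.precomp (g := Sum.inl) Sum.inl_injective
  have hZ : iIndepFun Z P := h.precomp (g := Sum.inr) Sum.inr_injective
  refine hX.prodMk_of_indepFun hZ mX mZ ?_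
  have hS := h.indepFun_finset (Finset.univ.image Sum.inl) (Finset.univ.image Sum.inr)
    (Finset.disjoint_left.2 (by simp)) (Sum.rec mX mZ)
  have ml : Measurable fun (x : (Finset.univ.image (Sum.inl : ι → ι ⊕ ι)) → α) (i : ι) =>
      x ⟨Sum.inl i, by simp⟩ := measurable_pi_lambda _ fun i => measurable_pi_apply _
  have mr : Measurable fun (x : (Finset.univ.image (Sum.inr : ι → ι ⊕ ι)) → α) (i : ι) =>
      x ⟨Sum.inr i, by simp⟩ := measurable_pi_lambda _ fun i => measurable_pi_apply _
  exact hS.comp ml mr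

end Independence

/-! ### Counts of a Poisson point set -/

namespace IsPoissonPointSet

variable {Ω E : Type*} [MeasurableSpace Ω] [TopologicalSpace E] [MeasurableSpace E] {S : Set E}
  {P : Measure Ω} {m : Measure E} {X : Ω → LocFin S}

theorem measurable_count (h : IsPoissonPointSet P m X) {B : Set E} (hB : MeasurableSet B) :
    Measurable fun ω => (X ω).count B :=
  (LocFin.measurable_count hB).comp h.measurable

theorem measureReal_count_eq (h : IsPoissonPointSet P m X) {B : Set E} (hB : MeasurableSet B)
    (hm : m B < ∞) (n : ℕ) : P.real {ω | (X ω).count B = n} =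
      Real.exp (-(m.real B)) * m.real B ^ n / n.factorial := by
  have h1 : P {ω | (X ω).count B = n} = P.map (fun ω => (X ω).count B) {(n : ℕ∞)} :=
    (Measure.map_apply (h.measurable_count hB) (measurableSet_singleton _)).symm
  have h2 : (fun n : ℕ => (n : ℕ∞)) ⁻¹' {(n : ℕ∞)} = {n} := by ext; simp
  rw [measureReal_def, h1, h.poisson B hB hm, Measure.map_apply (measurable_of_countable _)
    (measurableSet_singleton _), h2, ← measureReal_def, poissonMeasure_real_singleton]
  rfl

theorem iIndepFun_count (h : IsPoissonPointSet P m X) {ι : Type*} [Fintype ι] {B : ι → Set E}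
    (hB : ∀ i, MeasurableSet (B i)) (hd : Pairwise fun i j => Disjoint (B i) (B j)) :
    iIndepFun (fun i ω => (X ω).count (B i)) P := by
  let e := Fintype.equivFin ι
  have := (h.indep _ (fun k => B (e.symm k)) (fun k => hB _)
    fun i j hij => hd (e.symm.injective.ne hij)).precomp e.injective
  simpa using this

end IsPoissonPointSet

/-! ### Marks of time slots, expressed through counts -/

open LocFin

/-- The mark describing what happens during the time slot `(s, s']` in the window `[-lam, 0]`, if
there is at most one arrival or execution: `1` for an execution, the priority of the task for
an arrival, and `-2` otherwise. -/
noncomputable def slotMark (lam s s' : ℝ) (a : LocFin (Iic (0 : ℝ) ×ˢ Ici (0 : ℝ)))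
    (d : LocFin (Ici (0 : ℝ))) : ℝ :=
  open Classical in
  if a.count (Icc (-lam) 0 ×ˢ Ioc s s') + d.count (Ioc s s') = 1 then
    if d.count (Ioc s s') = 1 then 1
    -- The set is a singleton in this branch; `sInf` only extracts its element.
    else sInf (Prod.fst '' (a.pts ∩ Icc (-lam) 0 ×ˢ Ioc s s'))
  -- For `lam < 1` this mark lies below the window, so `act` ignores it.
  else -2

/-- The numbers of arrivals with priorities in `B`, of other arrivals, and of executions. -/
noncomputable def slotCounts (lam s s' : ℝ) (B : Set ℝ)
    (a : LocFin (Iic (0 : ℝ) ×ˢ Ici (0 : ℝ))) (d : LocFin (Ici (0 : ℝ))) : (ℕ∞ × ℕ∞) × ℕ∞ :=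
  ((a.count ((Icc (-lam) 0 ∩ B) ×ˢ Ioc s s'), a.count ((Icc (-lam) 0 \ B) ×ˢ Ioc s s')),
    d.count (Ioc s s'))

/-- The values of `slotCounts` for which the mark lies in `B`. -/
def slotCode (B : Set ℝ) : Set ((ℕ∞ × ℕ∞) × ℕ∞) :=
  {((1, 0), 0)} ∪ {x | x = ((0, 0), 1) ∧ 1 ∈ B} ∪ {x | x.1.1 + x.1.2 + x.2 ≠ 1 ∧ -2 ∈ B}

theorem ENat.add_eq_one_iff' {i j : ℕ∞} : i + j = 1 ↔ i = 1 ∧ j = 0 ∨ i = 0 ∧ j = 1 := by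
  constructor
  · intro h
    have hi : i ≠ ⊤ := by rintro rfl; simp at h
    have hj : j ≠ ⊤ := by rintro rfl; simp at h
    lift i to ℕ using hi
    lift j to ℕ using hj
    norm_cast at h ⊢
    omega
  · rintro (⟨rfl, rfl⟩ | ⟨rfl, rfl⟩) <;> simp

theorem LocFin.count_union {E : Type*} [TopologicalSpace E] {S : Set E} (y : LocFin S)
    {B C : Set E} (h : Disjoint B C) : y.count (B ∪ C) = y.count B + y.count C := by
  rw [count, inter_union_distrib_left, encard_union_eq]
  · rfl
  · exact h.mono inter_subset_right inter_subset_right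

theorem count_window_eq (lam s s' : ℝ) (B : Set ℝ) (a : LocFin (Iic (0 : ℝ) ×ˢ Ici (0 : ℝ))) :
    a.count (Icc (-lam) 0 ×ˢ Ioc s s') = a.count ((Icc (-lam) 0 ∩ B) ×ˢ Ioc s s') +
      a.count ((Icc (-lam) 0 \ B) ×ˢ Ioc s s') := by
  rw [← count_union, ← union_prod, inter_union_sdiff]
  exact Disjoint.set_prod_left disjoint_sdiff_inter.symm _ _

/-- When there is a single event and it is an arrival, its priority lies in `B` exactly if the count
over `B` is one. Measurability, independence and law of the marks thereby all reduce to counts of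
the driving Poisson sets. -/
theorem slotMark_mem_iff (lam s s' : ℝ) (B : Set ℝ) (a : LocFin (Iic (0 : ℝ) ×ˢ Ici (0 : ℝ)))
    (d : LocFin (Ici (0 : ℝ))) :
    slotMark lam s s' a d ∈ B ↔ slotCounts lam s s' B a d ∈ slotCode B := by
  have hc := count_window_eq lam s s' B a
  simp only [slotCode, slotCounts, mem_union, mem_singleton_iff, mem_ofPred_eq, Prod.mk.injEq,
    ← hc]
  unfold slotMark
  split_ifs with h1 h2
  · have h0 : a.count (Icc (-lam) 0 ×ˢ Ioc s s') = 0 := by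
      rcases ENat.add_eq_one_iff'.1 h1 with h | h
      · rw [h2] at h; simp at h
      · exact h.1
    have h0' := h0
    rw [hc, add_eq_zero] at h0'
    simp [h0'.1, h0'.2, h0, h2]
  · have hd : d.count (Ioc s s') = 0 ∧ a.count (Icc (-lam) 0 ×ˢ Ioc s s') = 1 := by
      rcases ENat.add_eq_one_iff'.1 h1 with h | h
      · exact ⟨h.2, h.1⟩
      · exact absurd h.2 h2
    obtain ⟨⟨p, t⟩, hpt⟩ := encard_eq_one.1 hd.2
    have hmem : (p, t) ∈ a.pts ∩ Icc (-lam) 0 ×ˢ Ioc s s' := hpt ▸ mem_singleton _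
    rw [hpt, image_singleton, csInf_singleton]
    have hone := hd.2
    rw [hc, ENat.add_eq_one_iff'] at hone
    simp only [hd.1, hd.2]
    constructor
    · intro hpB
      have : a.count ((Icc (-lam) 0 ∩ B) ×ˢ Ioc s s') ≠ 0 :=
        count_ne_zero.2 ⟨_, hmem.1, ⟨hmem.2.1, hpB⟩, hmem.2.2⟩
      rcases hone with h | h
      · simp [h]
      · exact absurd h.1 this
    · intro h
      by_contra hpB
      have : a.count ((Icc (-lam) 0 \ B) ×ˢ Ioc s s') ≠ 0 :=
        count_ne_zero.2 ⟨_, hmem.1, ⟨hmem.2.1, hpB⟩, hmem.2.2⟩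
      simp [this] at h
  · have e1 : ¬ ((a.count ((Icc (-lam) 0 ∩ B) ×ˢ Ioc s s') = 1 ∧
        a.count ((Icc (-lam) 0 \ B) ×ˢ Ioc s s') = 0) ∧ d.count (Ioc s s') = 0) := by
      rintro ⟨⟨e1, e2⟩, e3⟩
      exact h1 (by rw [hc, e1, e2, e3]; rfl)
    have e2 : ¬ (((a.count ((Icc (-lam) 0 ∩ B) ×ˢ Ioc s s') = 0 ∧
        a.count ((Icc (-lam) 0 \ B) ×ˢ Ioc s s') = 0) ∧ d.count (Ioc s s') = 1) ∧ 1 ∈ B) := by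
      rintro ⟨⟨⟨e1, e2⟩, e3⟩, -⟩
      exact h1 (by rw [hc, e1, e2, e3]; rfl)
    simp only [e1, e2, h1, ne_eq, not_false_eq_true, true_and, false_or]

/-! ### Independence and law of the slot counts -/

section Driving

variable {Ω : Type*} [MeasurableSpace Ω] {P : Measure Ω} [IsProbabilityMeasure P]
  {Pin : Ω → LocFin (Iic (0 : ℝ) ×ˢ Ici (0 : ℝ))} {Pout : Ω → LocFin (Ici (0 : ℝ))} {lam s s' : ℝ}

theorem measurable_slotCounts {B : Set ℝ} (hB : MeasurableSet B) (lam s s' : ℝ) :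
    Measurable fun x : LocFin (Iic (0 : ℝ) ×ˢ Ici (0 : ℝ)) × LocFin (Ici (0 : ℝ)) =>
      slotCounts lam s s' B x.1 x.2 :=
  ((((measurable_count ((measurableSet_Icc.inter hB).prod measurableSet_Ioc)).comp
    measurable_fst)).prodMk ((measurable_count ((measurableSet_Icc.diff hB).prod
      measurableSet_Ioc)).comp measurable_fst)).prodMk
    ((measurable_count measurableSet_Ioc).comp measurable_snd)

theorem measurable_slotMark (lam s s' : ℝ) :
    Measurable fun x : LocFin (Iic (0 : ℝ) ×ˢ Ici (0 : ℝ)) × LocFin (Ici (0 : ℝ)) =>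
      slotMark lam s s' x.1 x.2 := fun B hB => by
  have : (fun x : LocFin (Iic (0 : ℝ) ×ˢ Ici (0 : ℝ)) × LocFin (Ici (0 : ℝ)) =>
      slotMark lam s s' x.1 x.2) ⁻¹' B = (fun x => slotCounts lam s s' B x.1 x.2) ⁻¹' slotCode B := by
    ext x
    exact slotMark_mem_iff lam s s' B x.1 x.2
  rw [this]
  exact measurable_slotCounts hB lam s s' (MeasurableSet.of_discrete)

variable (hin : IsPoissonPointSet P (volume.restrict (Iic (0 : ℝ) ×ˢ Ici (0 : ℝ))) Pin)
  (hout : IsPoissonPointSet P (volume.restrict (Ici (0 : ℝ))) Pout) (hio : IndepFun Pin Pout P)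
include hin hout hio

/-- The numbers of points in disjoint time slots are independent. -/
theorem iIndepFun_slotCounts {ι : Type*} [Fintype ι] {t t' : ι → ℝ} {B : ι → Set ℝ}
    (hB : ∀ i, MeasurableSet (B i))
    (hd : Pairwise fun i j => Disjoint (Ioc (t i) (t' i)) (Ioc (t j) (t' j))) :
    iIndepFun (fun i ω => slotCounts lam (t i) (t' i) (B i) (Pin ω) (Pout ω)) P := by
  have m1 : ∀ i, MeasurableSet ((Icc (-lam) 0 ∩ B i) ×ˢ Ioc (t i) (t' i)) := fun i =>
    (measurableSet_Icc.inter (hB i)).prod measurableSet_Ioc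
  have m2 : ∀ i, MeasurableSet ((Icc (-lam) 0 \ B i) ×ˢ Ioc (t i) (t' i)) := fun i =>
    (measurableSet_Icc.diff (hB i)).prod measurableSet_Ioc
  -- Two boxes per slot, priorities inside and outside of `B i`, are pairwise disjoint over all
  -- slots. Independence of all these counts is then regrouped into pairs.
  have hi1 := hin.iIndepFun_count (ι := ι ⊕ ι)
    (B := Sum.elim (fun i => (Icc (-lam) 0 ∩ B i) ×ˢ Ioc (t i) (t' i))
      fun i => (Icc (-lam) 0 \ B i) ×ˢ Ioc (t i) (t' i)) (Sum.rec m1 m2) (by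
    have hne : ∀ i j, i ≠ j → ∀ C D : Set ℝ,
        Disjoint (C ×ˢ Ioc (t i) (t' i)) (D ×ˢ Ioc (t j) (t' j)) := fun i j hij C D =>
      Disjoint.set_prod_right (hd hij) _ _
    have hsame : ∀ i j, Disjoint ((Icc (-lam) 0 ∩ B i) ×ˢ Ioc (t i) (t' i))
        ((Icc (-lam) 0 \ B j) ×ˢ Ioc (t j) (t' j)) := fun i j => by
      by_cases h : i = j
      · subst h
        exact Disjoint.set_prod_left disjoint_sdiff_inter.symm _ _
      · exact hne i j h _ _
    rintro (i | i) (j | j) hij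
    · exact hne i j (fun h => hij (congrArg _ h)) _ _
    · exact hsame i j
    · exact (hsame j i).symm
    · exact hne i j (fun h => hij (congrArg _ h)) _ _)
  have hpair : iIndepFun (fun i ω => ((Pin ω).count ((Icc (-lam) 0 ∩ B i) ×ˢ Ioc (t i) (t' i)),
      (Pin ω).count ((Icc (-lam) 0 \ B i) ×ˢ Ioc (t i) (t' i)))) P := by
    refine iIndepFun.prodMk_of_sum (fun i => hin.measurable_count (m1 i))
      (fun i => hin.measurable_count (m2 i)) ?_
    convert hi1 using 1
    funext i
    rcases i with i | i <;> rfl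
  refine hpair.prodMk_of_indepFun (hout.iIndepFun_count (fun i => measurableSet_Ioc) hd)
    (fun i => (hin.measurable_count (m1 i)).prodMk (hin.measurable_count (m2 i)))
    (fun i => hout.measurable_count measurableSet_Ioc) ?_
  refine hio.comp (φ := fun a i => (a.count ((Icc (-lam) 0 ∩ B i) ×ˢ Ioc (t i) (t' i)),
    a.count ((Icc (-lam) 0 \ B i) ×ˢ Ioc (t i) (t' i)))) (ψ := fun d i => d.count (Ioc (t i) (t' i)))
    ?_ ?_
  · exact measurable_pi_lambda _ fun i => (measurable_count (m1 i)).prodMk (measurable_count (m2 i))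
  · exact measurable_pi_lambda _ fun i => measurable_count measurableSet_Ioc

omit [IsProbabilityMeasure P] in
theorem measureReal_slotCounts_eq {B : Set ℝ} (hB : MeasurableSet B) (hs : 0 ≤ s) (hss : s ≤ s')
    (n₁ n₂ n₃ : ℕ) :
    P.real {ω | slotCounts lam s s' B (Pin ω) (Pout ω) = (((n₁ : ℕ∞), (n₂ : ℕ∞)), (n₃ : ℕ∞))} =
      (Real.exp (-(volume.real (Icc (-lam) 0 ∩ B) * (s' - s))) *
        (volume.real (Icc (-lam) 0 ∩ B) * (s' - s)) ^ n₁ / n₁.factorial) *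
      (Real.exp (-(volume.real (Icc (-lam) 0 \ B) * (s' - s))) *
        (volume.real (Icc (-lam) 0 \ B) * (s' - s)) ^ n₂ / n₂.factorial) *
      (Real.exp (-(s' - s)) * (s' - s) ^ n₃ / n₃.factorial) := by
  have hm1 : MeasurableSet ((Icc (-lam) 0 ∩ B) ×ˢ Ioc s s') :=
    (measurableSet_Icc.inter hB).prod measurableSet_Ioc
  have hm2 : MeasurableSet ((Icc (-lam) 0 \ B) ×ˢ Ioc s s') :=
    (measurableSet_Icc.diff hB).prod measurableSet_Ioc
  have hI : Ioc s s' ⊆ Ici 0 := fun x hx => hs.trans hx.1.le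
  have hvol : ∀ C ⊆ Icc (-lam) (0 : ℝ), MeasurableSet C →
      (volume.restrict (Iic (0 : ℝ) ×ˢ Ici (0 : ℝ))) (C ×ˢ Ioc s s') =
        volume C * ENNReal.ofReal (s' - s) := fun C hC hCm => by
    rw [Measure.restrict_apply (hCm.prod measurableSet_Ioc), inter_eq_left.2
      (prod_mono (hC.trans Icc_subset_Iic_self) hI), Measure.volume_eq_prod, Measure.prod_prod,
      Real.volume_Ioc]
  have hfin : ∀ C ⊆ Icc (-lam) (0 : ℝ), volume C < ∞ := fun C hC =>
    (measure_mono hC).trans_lt (by rw [Real.volume_Icc]; exact ENNReal.ofReal_lt_top)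
  have hvr : ∀ C ⊆ Icc (-lam) (0 : ℝ), MeasurableSet C →
      (volume.restrict (Iic (0 : ℝ) ×ˢ Ici (0 : ℝ))).real (C ×ˢ Ioc s s') =
        volume.real C * (s' - s) := fun C hC hCm => by
    rw [measureReal_def, hvol C hC hCm, ENNReal.toReal_mul, ENNReal.toReal_ofReal (by linarith)]
    rfl
  have hvf : ∀ C ⊆ Icc (-lam) (0 : ℝ), MeasurableSet C →
      (volume.restrict (Iic (0 : ℝ) ×ˢ Ici (0 : ℝ))) (C ×ˢ Ioc s s') < ∞ := fun C hC hCm => by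
    rw [hvol C hC hCm]
    exact ENNReal.mul_lt_top (hfin C hC) ENNReal.ofReal_lt_top
  have hvo : (volume.restrict (Ici (0 : ℝ))) (Ioc s s') = ENNReal.ofReal (s' - s) := by
    rw [Measure.restrict_apply measurableSet_Ioc, inter_eq_left.2 hI, Real.volume_Ioc]
  have hind : IndepFun (fun ω => (Pin ω).count ((Icc (-lam) 0 ∩ B) ×ˢ Ioc s s'))
      (fun ω => (Pin ω).count ((Icc (-lam) 0 \ B) ×ˢ Ioc s s')) P := by
    have := hin.indep 2 ![(Icc (-lam) 0 ∩ B) ×ˢ Ioc s s', (Icc (-lam) 0 \ B) ×ˢ Ioc s s']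
      (fun i => by fin_cases i; exacts [hm1, hm2]) (fun i j hij => by
        have hdj : Disjoint ((Icc (-lam) 0 ∩ B) ×ˢ Ioc s s') ((Icc (-lam) 0 \ B) ×ˢ Ioc s s') :=
          Disjoint.set_prod_left disjoint_sdiff_inter.symm _ _
        fin_cases i <;> fin_cases j
        · exact absurd rfl hij
        · exact hdj
        · exact hdj.symm
        · exact absurd rfl hij)
    exact this.indepFun (i := 0) (j := 1) (by simp)
  have hind2 : IndepFun (fun ω => ((Pin ω).count ((Icc (-lam) 0 ∩ B) ×ˢ Ioc s s'),
      (Pin ω).count ((Icc (-lam) 0 \ B) ×ˢ Ioc s s'))) (fun ω => (Pout ω).count (Ioc s s')) P :=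
    hio.comp (φ := fun a => (a.count ((Icc (-lam) 0 ∩ B) ×ˢ Ioc s s'),
      a.count ((Icc (-lam) 0 \ B) ×ˢ Ioc s s'))) (ψ := fun d => d.count (Ioc s s'))
      ((measurable_count hm1).prodMk (measurable_count hm2)) (measurable_count measurableSet_Ioc)
  have e1 : {ω | slotCounts lam s s' B (Pin ω) (Pout ω) = (((n₁ : ℕ∞), (n₂ : ℕ∞)), (n₃ : ℕ∞))} =
      (fun ω => ((Pin ω).count ((Icc (-lam) 0 ∩ B) ×ˢ Ioc s s'),
        (Pin ω).count ((Icc (-lam) 0 \ B) ×ˢ Ioc s s'))) ⁻¹' {((n₁ : ℕ∞), (n₂ : ℕ∞))} ∩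
      (fun ω => (Pout ω).count (Ioc s s')) ⁻¹' {(n₃ : ℕ∞)} := by
    ext ω; simp [slotCounts]
  have e2 : (fun ω => ((Pin ω).count ((Icc (-lam) 0 ∩ B) ×ˢ Ioc s s'),
        (Pin ω).count ((Icc (-lam) 0 \ B) ×ˢ Ioc s s'))) ⁻¹' {((n₁ : ℕ∞), (n₂ : ℕ∞))} =
      (fun ω => (Pin ω).count ((Icc (-lam) 0 ∩ B) ×ˢ Ioc s s')) ⁻¹' {(n₁ : ℕ∞)} ∩
      (fun ω => (Pin ω).count ((Icc (-lam) 0 \ B) ×ˢ Ioc s s')) ⁻¹' {(n₂ : ℕ∞)} := by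
    ext ω; simp
  rw [e1, measureReal_def, hind2.measure_inter_preimage_eq_mul _ _ (measurableSet_singleton _)
    (measurableSet_singleton _), e2, hind.measure_inter_preimage_eq_mul _ _
    (measurableSet_singleton _) (measurableSet_singleton _), ENNReal.toReal_mul,
    ENNReal.toReal_mul, ← hvr _ inter_subset_left (measurableSet_Icc.inter hB),
    ← hvr _ sdiff_subset (measurableSet_Icc.diff hB),
    ← hin.measureReal_count_eq hm1 (hvf _ inter_subset_left (measurableSet_Icc.inter hB)),
    ← hin.measureReal_count_eq hm2 (hvf _ sdiff_subset (measurableSet_Icc.diff hB))]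
  have h3 := hout.measureReal_count_eq (B := Ioc s s') measurableSet_Ioc
    (by rw [hvo]; exact ENNReal.ofReal_lt_top) n₃
  rw [measureReal_def (volume.restrict (Ici (0 : ℝ))), hvo, ENNReal.toReal_ofReal (by linarith)]
    at h3
  rw [← h3]
  rfl

end Driving

/-! ### The law of the mark of a slot -/

open LocFin

/-- The probability that a time slot of length `h` contains exactly one execution and no arrival
in the window `[-lam, 0]`. -/
noncomputable def slotRate (lam h : ℝ) : ℝ := h * Real.exp (-((1 + lam) * h))

theorem volume_real_inter_add (lam : ℝ) (hlam : 0 ≤ lam) {B : Set ℝ} (hB : MeasurableSet B) :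
    volume.real (Icc (-lam) 0 ∩ B) + volume.real (Icc (-lam) 0 \ B) = lam := by
  rw [measureReal_inter_add_sdiff hB (by rw [Real.volume_Icc]; exact ENNReal.ofReal_ne_top)]
  simp [hlam]

theorem exp_window_mul {lam : ℝ} (hlam : 0 ≤ lam) {B : Set ℝ} (hB : MeasurableSet B) (h : ℝ) :
    Real.exp (-((1 + lam) * h)) = Real.exp (-(volume.real (Icc (-lam) 0 ∩ B) * h)) *
      Real.exp (-(volume.real (Icc (-lam) 0 \ B) * h)) * Real.exp (-h) := by
  rw [← Real.exp_add, ← Real.exp_add]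
  congr 1
  linear_combination h * volume_real_inter_add lam hlam hB

section SlotLaw

variable {Ω : Type*} [MeasurableSpace Ω] {P : Measure Ω} [IsProbabilityMeasure P]
  {Pin : Ω → LocFin (Iic (0 : ℝ) ×ˢ Ici (0 : ℝ))} {Pout : Ω → LocFin (Ici (0 : ℝ))} {lam s s' : ℝ}
  (hin : IsPoissonPointSet P (volume.restrict (Iic (0 : ℝ) ×ˢ Ici (0 : ℝ))) Pin)
  (hout : IsPoissonPointSet P (volume.restrict (Ici (0 : ℝ))) Pout) (hio : IndepFun Pin Pout P)
include hin hout hio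

theorem measureReal_slotCounts_sum_eq_one (hlam : 0 ≤ lam) {B : Set ℝ} (hB : MeasurableSet B)
    (hs : 0 ≤ s) (hss : s ≤ s') :
    (P.map fun ω => slotCounts lam s s' B (Pin ω) (Pout ω)).real {x | x.1.1 + x.1.2 + x.2 = 1} =
      (1 + lam) * slotRate lam (s' - s) := by
  have hX : Measurable fun ω => slotCounts lam s s' B (Pin ω) (Pout ω) :=
    (measurable_slotCounts hB lam s s').comp (hin.measurable.prodMk hout.measurable)
  have hL : ∀ n₁ n₂ n₃ : ℕ, (P.map fun ω => slotCounts lam s s' B (Pin ω) (Pout ω)).real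
      {(((n₁ : ℕ∞), (n₂ : ℕ∞)), (n₃ : ℕ∞))} = _ := fun n₁ n₂ n₃ =>
    (map_measureReal_apply hX (measurableSet_singleton _)).trans
      (measureReal_slotCounts_eq hin hout hio hB hs hss n₁ n₂ n₃)
  have hset : {x : (ℕ∞ × ℕ∞) × ℕ∞ | x.1.1 + x.1.2 + x.2 = 1} =
      {((((1 : ℕ) : ℕ∞), ((0 : ℕ) : ℕ∞)), ((0 : ℕ) : ℕ∞))} ∪
        {((((0 : ℕ) : ℕ∞), ((1 : ℕ) : ℕ∞)), ((0 : ℕ) : ℕ∞))} ∪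
        {((((0 : ℕ) : ℕ∞), ((0 : ℕ) : ℕ∞)), ((1 : ℕ) : ℕ∞))} := by
    ext ⟨⟨i, j⟩, k⟩
    simp only [mem_ofPred_eq, ENat.add_eq_one_iff', add_eq_zero]
    simp
    tauto
  have : IsProbabilityMeasure (P.map fun ω => slotCounts lam s s' B (Pin ω) (Pout ω)) :=
    Measure.isProbabilityMeasure_map hX.aemeasurable
  rw [hset, measureReal_union (by simp) (measurableSet_singleton _),
    measureReal_union (by simp) (measurableSet_singleton _), hL, hL, hL]
  have hv := volume_real_inter_add lam hlam hB
  rw [slotRate, exp_window_mul hlam hB]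
  simp only [pow_zero, pow_one, Nat.factorial_zero, Nat.factorial_one, Nat.cast_one, div_one,
    mul_one]
  linear_combination ((s' - s) * (Real.exp (-(volume.real (Icc (-lam) 0 ∩ B) * (s' - s))) *
      Real.exp (-(volume.real (Icc (-lam) 0 \ B) * (s' - s))) * Real.exp (-(s' - s)))) * hv

/-- The three parts of `slotCode` are disjoint. Both driving sets have intensity one, so the same
factor `slotRate` multiplies the volume of priorities and the atom of executions; all other outcomes
share the inert mark. -/
theorem measureReal_slotMark_mem (hlam : 0 ≤ lam) {B : Set ℝ} (hB : MeasurableSet B)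
    (hs : 0 ≤ s) (hss : s ≤ s') :
    P.real {ω | slotMark lam s s' (Pin ω) (Pout ω) ∈ B} =
      slotRate lam (s' - s) * volume.real (Icc (-lam) 0 ∩ B) +
      slotRate lam (s' - s) * B.indicator 1 1 +
      (1 - (1 + lam) * slotRate lam (s' - s)) * B.indicator 1 (-2) := by
  classical
  have hX : Measurable fun ω => slotCounts lam s s' B (Pin ω) (Pout ω) :=
    (measurable_slotCounts hB lam s s').comp (hin.measurable.prodMk hout.measurable)
  have hL : ∀ n₁ n₂ n₃ : ℕ, (P.map fun ω => slotCounts lam s s' B (Pin ω) (Pout ω)).real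
      {(((n₁ : ℕ∞), (n₂ : ℕ∞)), (n₃ : ℕ∞))} = _ := fun n₁ n₂ n₃ =>
    (map_measureReal_apply hX (measurableSet_singleton _)).trans
      (measureReal_slotCounts_eq hin hout hio hB hs hss n₁ n₂ n₃)
  have : IsProbabilityMeasure (P.map fun ω => slotCounts lam s s' B (Pin ω) (Pout ω)) :=
    Measure.isProbabilityMeasure_map hX.aemeasurable
  have hsum := measureReal_slotCounts_sum_eq_one hin hout hio hlam hB hs hss
  have hev : {ω | slotMark lam s s' (Pin ω) (Pout ω) ∈ B} =
      (fun ω => slotCounts lam s s' B (Pin ω) (Pout ω)) ⁻¹' slotCode B := by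
    ext ω; exact slotMark_mem_iff lam s s' B _ _
  have h100 := hL 1 0 0
  have h001 := hL 0 0 1
  set L := P.map fun ω => slotCounts lam s s' B (Pin ω) (Pout ω)
  have h2 : L.real {x | x = ((0, 0), 1) ∧ (1 : ℝ) ∈ B} =
      slotRate lam (s' - s) * B.indicator 1 1 := by
    by_cases h : (1 : ℝ) ∈ B
    · simp only [h, and_true, indicator_of_mem, Pi.one_apply, mul_one]
      refine Eq.trans ?_ (h001.trans ?_)
      · congr 1
      · rw [slotRate, exp_window_mul hlam hB]
        simp
        ring
    · simp [h]
  have h3 : L.real {x | x.1.1 + x.1.2 + x.2 ≠ 1 ∧ (-2 : ℝ) ∈ B} =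
      (1 - (1 + lam) * slotRate lam (s' - s)) * B.indicator 1 (-2) := by
    by_cases h : (-2 : ℝ) ∈ B
    · simp only [h, and_true, indicator_of_mem, Pi.one_apply, mul_one]
      rw [← hsum, ← probReal_compl_eq_one_sub MeasurableSet.of_discrete]
      rfl
    · simp [h]
  have h1 : L.real {((1, 0), 0)} = slotRate lam (s' - s) * volume.real (Icc (-lam) 0 ∩ B) := by
    refine Eq.trans ?_ (h100.trans ?_)
    · congr 1
    · rw [slotRate, exp_window_mul hlam hB]
      simp
      ring
  have hd1 : Disjoint ({((1, 0), 0)} : Set ((ℕ∞ × ℕ∞) × ℕ∞)) {x | x = ((0, 0), 1) ∧ (1 : ℝ) ∈ B} := by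
    simp
  have hd2 : Disjoint ({((1, 0), 0)} ∪ {x : (ℕ∞ × ℕ∞) × ℕ∞ | x = ((0, 0), 1) ∧ (1 : ℝ) ∈ B})
      {x | x.1.1 + x.1.2 + x.2 ≠ 1 ∧ (-2 : ℝ) ∈ B} := by
    refine Set.disjoint_left.2 ?_
    rintro x (rfl | ⟨rfl, -⟩) ⟨hx, -⟩ <;> simp at hx
  rw [hev, ← map_measureReal_apply hX MeasurableSet.of_discrete, slotCode,
    measureReal_union hd2 MeasurableSet.of_discrete,
    measureReal_union hd1 MeasurableSet.of_discrete, h1, h2, h3]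

/-- With high probability, a short time slot contains at most one arrival or execution. -/
theorem measureReal_slot_bad_le (hlam : 0 ≤ lam) (hs : 0 ≤ s) (hss : s ≤ s') :
    P.real {ω | ¬ ((Pin ω).count (Icc (-lam) 0 ×ˢ Ioc s s') + (Pout ω).count (Ioc s s') ≤ 1)} ≤
      ((1 + lam) * (s' - s)) ^ 2 := by
  have hX : Measurable fun ω => slotCounts lam s s' univ (Pin ω) (Pout ω) :=
    (measurable_slotCounts MeasurableSet.univ lam s s').comp
      (hin.measurable.prodMk hout.measurable)
  have h0 := measureReal_slotCounts_eq (lam := lam) hin hout hio MeasurableSet.univ hs hss 0 0 0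
  have h1 := measureReal_slotCounts_sum_eq_one hin hout hio hlam MeasurableSet.univ hs hss
  rw [map_measureReal_apply hX MeasurableSet.of_discrete] at h1
  have hle : ∀ i : ℕ∞, i ≤ 1 → i = 0 ∨ i = 1 := fun i hi => by
    lift i to ℕ using (by rintro rfl; simp at hi)
    norm_cast at hi ⊢
    omega
  have hset : {ω | ¬ ((Pin ω).count (Icc (-lam) 0 ×ˢ Ioc s s') + (Pout ω).count (Ioc s s') ≤ 1)} =
      ((fun ω => slotCounts lam s s' univ (Pin ω) (Pout ω)) ⁻¹' {x | x.1.1 + x.1.2 + x.2 = 1} ∪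
        {ω | slotCounts lam s s' univ (Pin ω) (Pout ω) =
          ((((0 : ℕ) : ℕ∞), ((0 : ℕ) : ℕ∞)), ((0 : ℕ) : ℕ∞))})ᶜ := by
    ext ω
    simp only [mem_ofPred_eq, mem_compl_iff, mem_union, mem_preimage, slotCounts,
      count_window_eq lam s s' univ (Pin ω)]
    refine not_congr ⟨fun h => ?_, fun h => ?_⟩
    · rcases hle _ h with h | h
      · right
        simp only [add_eq_zero] at h
        rw [h.1.1, h.1.2, h.2, Nat.cast_zero]
      · exact Or.inl h
    · rcases h with h | h
      · exact h.le
      · simp only [Prod.mk.injEq, Nat.cast_zero] at h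
        rw [h.1.1, h.1.2, h.2]
        simp
  have hm0 : MeasurableSet {ω | slotCounts lam s s' univ (Pin ω) (Pout ω) =
      ((((0 : ℕ) : ℕ∞), ((0 : ℕ) : ℕ∞)), ((0 : ℕ) : ℕ∞))} := hX (measurableSet_singleton _)
  have hm1 : MeasurableSet ((fun ω => slotCounts lam s s' univ (Pin ω) (Pout ω)) ⁻¹'
      {x | x.1.1 + x.1.2 + x.2 = 1}) := hX MeasurableSet.of_discrete
  rw [hset, probReal_compl_eq_one_sub (hm1.union hm0), measureReal_union ?_ hm0, h1, h0]
  · simp only [pow_zero, Nat.factorial_zero, Nat.cast_one, div_one, mul_one]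
    rw [← exp_window_mul hlam MeasurableSet.univ, slotRate]
    have hx : 0 ≤ (1 + lam) * (s' - s) := mul_nonneg (by linarith) (by linarith)
    -- With `x = (1 + lam) * (s' - s)`, the probability is `1 - (1 + x) * exp (-x)`, and `1 - x ≤
    -- exp (-x)` bounds it by `1 - (1 + x) * (1 - x) = x ^ 2`.
    have := Real.add_one_le_exp (-((1 + lam) * (s' - s)))
    nlinarith
  · refine Set.disjoint_left.2 fun ω hω hω' => ?_
    simp only [mem_preimage, mem_ofPred_eq] at hω hω'
    rw [hω'] at hω
    simp at hω

end SlotLaw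

/-! ### The slot marks as an i.i.d. sequence -/

/-- The law of the mark of a time slot of length `h`. -/
noncomputable def slotLaw (lam h : ℝ) : Measure ℝ :=
  ENNReal.ofReal (slotRate lam h) • volume.restrict (Icc (-lam) 0) +
    ENNReal.ofReal (slotRate lam h) • Measure.dirac 1 +
    ENNReal.ofReal (1 - (1 + lam) * slotRate lam h) • Measure.dirac (-2)

instance (lam h : ℝ) : IsFiniteMeasure (slotLaw lam h) := by
  unfold slotLaw
  have := fun c : ℝ => Measure.smul_finite (volume.restrict (Icc (-lam) 0)) (ENNReal.ofReal_ne_top (r := c))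
  have := fun c x : ℝ => Measure.smul_finite (Measure.dirac x) (ENNReal.ofReal_ne_top (r := c))
  infer_instance

theorem slotRate_nonneg (lam : ℝ) {h : ℝ} (hh : 0 ≤ h) : 0 ≤ slotRate lam h :=
  mul_nonneg hh (Real.exp_nonneg _)

theorem slotRate_le (hlam : 0 ≤ lam) {h : ℝ} (hh : 0 ≤ h) : slotRate lam h ≤ h :=
  mul_le_of_le_one_right hh (Real.exp_le_one_iff.2 (by
    have := mul_nonneg (by linarith : 0 ≤ 1 + lam) hh
    linarith))

open LocFin

theorem slotRate_mul_le_one {lam : ℝ} (h : ℝ) : (1 + lam) * slotRate lam h ≤ 1 := by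
  have h1 := Real.add_one_le_exp ((1 + lam) * h)
  have h2 : Real.exp ((1 + lam) * h) * Real.exp (-((1 + lam) * h)) = 1 := by
    rw [← Real.exp_add]; simp
  have h3 := Real.exp_pos (-((1 + lam) * h))
  unfold slotRate
  nlinarith

theorem measureReal_slotLaw {lam h : ℝ} (hh : 0 ≤ h) {B : Set ℝ}
    (hB : MeasurableSet B) : (slotLaw lam h).real B =
      slotRate lam h * volume.real (Icc (-lam) 0 ∩ B) + slotRate lam h * B.indicator 1 1 +
      (1 - (1 + lam) * slotRate lam h) * B.indicator 1 (-2) := by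
  have hd : ∀ x : ℝ, (Measure.dirac x).real B = B.indicator 1 x := fun x => by
    rw [measureReal_def, Measure.dirac_apply' _ hB]
    by_cases hx : x ∈ B <;> simp [hx]
  have hv : volume (B ∩ Icc (-lam) 0) ≠ ∞ :=
    ((measure_mono inter_subset_right).trans_lt
      (by rw [Real.volume_Icc]; exact ENNReal.ofReal_lt_top)).ne
  rw [slotLaw, measureReal_def, Measure.add_apply, Measure.add_apply, Measure.smul_apply,
    Measure.smul_apply, Measure.smul_apply, Measure.restrict_apply hB, smul_eq_mul, smul_eq_mul,
    smul_eq_mul, ENNReal.toReal_add, ENNReal.toReal_add, ENNReal.toReal_mul, ENNReal.toReal_mul,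
    ENNReal.toReal_mul, ENNReal.toReal_ofReal (slotRate_nonneg lam hh),
    ENNReal.toReal_ofReal (sub_nonneg.2 (slotRate_mul_le_one h)), ← measureReal_def,
    ← measureReal_def, ← measureReal_def, hd, hd, inter_comm B]
  all_goals finiteness

section SlotLaw

variable {Ω : Type*} [MeasurableSpace Ω] {P : Measure Ω} [IsProbabilityMeasure P]
  {Pin : Ω → LocFin (Iic (0 : ℝ) ×ˢ Ici (0 : ℝ))} {Pout : Ω → LocFin (Ici (0 : ℝ))} {lam : ℝ}
  (hin : IsPoissonPointSet P (volume.restrict (Iic (0 : ℝ) ×ˢ Ici (0 : ℝ))) Pin)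
  (hout : IsPoissonPointSet P (volume.restrict (Ici (0 : ℝ))) Pout) (hio : IndepFun Pin Pout P)
include hin hout hio

theorem measure_slotMark_mem (hlam : 0 ≤ lam) {s s' : ℝ} {B : Set ℝ} (hB : MeasurableSet B)
    (hs : 0 ≤ s) (hss : s ≤ s') :
    P {ω | slotMark lam s s' (Pin ω) (Pout ω) ∈ B} = slotLaw lam (s' - s) B := by
  rw [← ENNReal.toReal_eq_toReal_iff' (measure_ne_top _ _) (measure_ne_top _ _),
    ← measureReal_def, ← measureReal_def, measureReal_slotLaw (by linarith) hB,
    measureReal_slotMark_mem hin hout hio hlam hB hs hss]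

/-- The marks of consecutive time slots of length `h` are independent with law `slotLaw lam h`. -/
theorem map_slotMarks (hlam : 0 ≤ lam) {h : ℝ} (hh : 0 ≤ h) (m : ℕ) :
    P.map (fun ω (k : Fin m) => slotMark lam (k * h) ((k + 1) * h) (Pin ω) (Pout ω)) =
      Measure.pi fun _ => slotLaw lam h := by
  have hM : Measurable fun ω (k : Fin m) => slotMark lam (k * h) ((k + 1) * h) (Pin ω) (Pout ω) :=
    measurable_pi_lambda _ fun k => by
      have h1 : Measurable fun ω => (Pin ω, Pout ω) := hin.measurable.prodMk hout.measurable
      have h2 := (measurable_slotMark lam (k * h) ((k + 1) * h)).comp h1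
      exact h2
  refine (Measure.pi_eq fun B hB => ?_).symm
  have hdisj : Pairwise fun i j : Fin m =>
      Disjoint (Ioc ((i : ℝ) * h) ((i + 1) * h)) (Ioc ((j : ℝ) * h) ((j + 1) * h)) := by
    have : ∀ i j : Fin m, i < j →
        Disjoint (Ioc ((i : ℝ) * h) ((i + 1) * h)) (Ioc ((j : ℝ) * h) ((j + 1) * h)) :=
      fun i j hij => by
        refine Set.disjoint_left.2 fun x hx hx' => ?_
        have h1 : ((i : ℕ) : ℝ) + 1 ≤ (j : ℕ) := by exact_mod_cast hij
        have h2 := mul_le_mul_of_nonneg_right h1 hh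
        linarith [hx.2, hx'.1]
    intro i j hij
    rcases lt_or_gt_of_ne hij with h | h
    · exact this i j h
    · exact (this j i h).symm
  -- A product measure is determined by boxes, and a box requires a different test set `B k` in each
  -- slot.
  have hind := iIndepFun_slotCounts (lam := lam) hin hout hio hB hdisj
  have hcode : ∀ k : Fin m, {ω | slotMark lam (k * h) ((k + 1) * h) (Pin ω) (Pout ω) ∈ B k} =
      (fun ω => slotCounts lam (k * h) ((k + 1) * h) (B k) (Pin ω) (Pout ω)) ⁻¹'
        slotCode (B k) := fun k => by
    ext ω; exact slotMark_mem_iff _ _ _ _ _ _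
  have hset : (fun ω (k : Fin m) => slotMark lam (k * h) ((k + 1) * h) (Pin ω) (Pout ω)) ⁻¹'
      univ.pi B = ⋂ k : Fin m, (fun ω => slotCounts lam (k * h) ((k + 1) * h) (B k) (Pin ω) (Pout ω)) ⁻¹'
        slotCode (B k) := by
    simp_rw [← hcode]
    ext ω
    simp
  rw [Measure.map_apply hM (MeasurableSet.univ_pi hB), hset,
    hind.meas_iInter fun k => ⟨_, MeasurableSet.of_discrete, rfl⟩]
  refine Finset.prod_congr rfl fun k _ => ?_
  rw [← hcode, measure_slotMark_mem hin hout hio hlam (hB k) (by positivity)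
    (by nlinarith)]
  congr 2
  ring

end SlotLaw

/-! ### The slot chain as a lazy embedded chain -/

namespace Inbox

variable {lam : ℝ}

/-- Write `a` for the slot rate. The inert mass `1 - (1 + lam) * a` splits into `1 - 2 * a`, the
laziness, and `a * (1 - lam)`, which is what `2 * a` times `markLaw` gives to the ignored priorities
in `[-1, -lam)`. The bound on `h` keeps `1 - 2 * a` nonnegative. -/
theorem stepOp_slotLaw (h0 : 0 ≤ lam) (h1 : lam < 1) {h : ℝ} (hh : 0 ≤ h) (hh' : h ≤ 1 / 2)
    {f : Inbox lam → ℝ≥0∞} (hf : Measurable f) (y : Inbox lam) :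
    stepOp (slotLaw lam h) f y = ENNReal.ofReal (1 - 2 * slotRate lam h) * f y +
      ENNReal.ofReal (2 * slotRate lam h) * stepOp markLaw f y := by
  have ha := slotRate_nonneg lam hh
  have ha' := slotRate_le h0 hh
  have hm : Measurable fun u : ℝ => f (act u y) :=
    hf.comp (measurable_act.comp (measurable_id.prodMk measurable_const))
  have e2 : ENNReal.ofReal (2 * slotRate lam h) = 2 * ENNReal.ofReal (slotRate lam h) := by
    rw [ENNReal.ofReal_mul (by norm_num), ENNReal.ofReal_ofNat]
  have e3 : ENNReal.ofReal (1 - (1 + lam) * slotRate lam h) =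
      ENNReal.ofReal (1 - 2 * slotRate lam h) +
        ENNReal.ofReal (slotRate lam h) * ENNReal.ofReal (1 - lam) := by
    rw [← ENNReal.ofReal_mul ha, ← ENNReal.ofReal_add (by linarith)
      (mul_nonneg ha (by linarith))]
    congr 1; ring
  have e4 : ∫⁻ u in Icc (-lam) 0, f (act u y) = ∫⁻ u in Icc (-lam) 0, f (insertTask u y) :=
    setLIntegral_congr_fun measurableSet_Icc fun u hu => by rw [act_of_nonpos hu.2]
  rw [stepOp_markLaw h0 h1, stepOp, slotLaw, lintegral_add_measure, lintegral_add_measure,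
    lintegral_smul_measure, lintegral_smul_measure, lintegral_smul_measure,
    lintegral_dirac' _ hm, lintegral_dirac' _ hm, act_of_pos one_pos,
    act_of_lt h0 (by linarith), e2, e3, e4, mul_comm 2 (ENNReal.ofReal (slotRate lam h)), mul_assoc,
    ← mul_assoc 2 2⁻¹, ENNReal.mul_inv_cancel two_ne_zero ENNReal.ofNat_ne_top]
  simp only [smul_eq_mul]
  ring

end Inbox

/-! ### Trajectories between events and over one slot -/

namespace IsInboxPath

variable {lam s s' : ℝ} {y₀ : Set ℝ} {A : Set (ℝ × ℝ)} {D : Set ℝ} {X : ℝ → Set ℝ}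

/-- For the discrete topology on states, being locally constant is continuity, and a continuous map
from a connected interval to a discrete space is constant. -/
theorem eq_of_no_event_Ioo (hX : IsInboxPath lam y₀ A D X) (hs : 0 ≤ s)
    (hno : ∀ r ∈ Ioo s s', (∀ p ∈ Icc (-lam) 0, (p, r) ∉ A) ∧ r ∉ D) {r : ℝ}
    (hr : r ∈ Ico s s') : X r = X s := by
  let _ : TopologicalSpace (Set ℝ) := ⊥
  have : DiscreteTopology (Set ℝ) := ⟨rfl⟩
  have hc : ContinuousOn X (Ico s s') := fun r hr => by
    rw [ContinuousWithinAt, nhds_discrete, tendsto_pure]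
    have hright := hX.right_continuous r (hs.trans hr.1)
    have hge : ∀ᶠ x in 𝓝[≥] r, X x = X r := by
      rw [← Ioi_insert, nhdsWithin_insert, eventually_sup]
      exact ⟨eventually_pure.2 rfl, hright⟩
    rcases hr.1.eq_or_lt with rfl | hsr
    · exact hge.filter_mono (nhdsWithin_mono _ Ico_subset_Ici_self)
    · obtain ⟨L, hL, -, -, h3⟩ := hX.rules r (hs.trans_lt hsr)
      have hrL := h3 (hno r ⟨hsr, hr.2⟩).1 (hno r ⟨hsr, hr.2⟩).2
      refine Eventually.filter_mono nhdsWithin_le_nhds ?_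
      rw [← nhdsLT_sup_nhdsGE, eventually_sup]
      exact ⟨hrL ▸ hL, hge⟩
  exact isPreconnected_Ico.constant hc hr ⟨le_rfl, hr.1.trans_lt hr.2⟩

theorem rules_of_no_event (hX : IsInboxPath lam y₀ A D X) (hs : 0 ≤ s) (hss : s < s')
    (hno : ∀ r ∈ Ioo s s', (∀ p ∈ Icc (-lam) 0, (p, r) ∉ A) ∧ r ∉ D) :
    (∀ p ∈ Icc (-lam) 0, (p, s') ∈ A → X s' = X s ∪ {p}) ∧
    (s' ∈ D → X s' = X s \ {q | IsGreatest (X s) q}) ∧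
    ((∀ p ∈ Icc (-lam) 0, (p, s') ∉ A) → s' ∉ D → X s' = X s) := by
  obtain ⟨L, hL, h⟩ := hX.rules s' (hs.trans_lt hss)
  obtain ⟨r, hrL, hr⟩ := (hL.and (Ioo_mem_nhdsLT hss)).exists
  have : L = X s := hrL.symm.trans (hX.eq_of_no_event_Ioo hs hno ⟨hr.1.le, hr.2⟩)
  rwa [this] at h

theorem eq_of_no_event_Ioc (hX : IsInboxPath lam y₀ A D X) (hs : 0 ≤ s) (hss : s ≤ s')
    (hno : ∀ r ∈ Ioc s s', (∀ p ∈ Icc (-lam) 0, (p, r) ∉ A) ∧ r ∉ D) : X s' = X s := by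
  rcases hss.eq_or_lt with rfl | hlt
  · rfl
  · have h := hno s' ⟨hlt, le_rfl⟩
    exact (hX.rules_of_no_event hs hlt fun r hr => hno r ⟨hr.1, hr.2.le⟩).2.2 h.1 h.2

/-- Over a time slot with at most one event, the inbox changes by the action of the mark. -/
theorem eq_act_slotMark {a : LocFin (Iic (0 : ℝ) ×ˢ Ici (0 : ℝ))} {d : LocFin (Ici (0 : ℝ))}
    (hX : IsInboxPath lam y₀ a.pts d.pts X) (h0 : 0 ≤ lam) (h1 : lam < 1) (hs : 0 ≤ s)
    (hss : s ≤ s') (hle : a.count (Icc (-lam) 0 ×ˢ Ioc s s') + d.count (Ioc s s') ≤ 1)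
    {x x' : Inbox lam} (hx : x.pts = X s) (hx' : x'.pts = X s') :
    x' = Inbox.act (slotMark lam s s' a d) x := by
  have hcases : (a.count (Icc (-lam) 0 ×ˢ Ioc s s') = 0 ∧ d.count (Ioc s s') = 0) ∨
      (a.count (Icc (-lam) 0 ×ˢ Ioc s s') = 1 ∧ d.count (Ioc s s') = 0) ∨
      (a.count (Icc (-lam) 0 ×ˢ Ioc s s') = 0 ∧ d.count (Ioc s s') = 1) := by
    rcases hle.eq_or_lt with h | h
    · exact Or.inr (ENat.add_eq_one_iff'.1 h)
    · exact Or.inl (add_eq_zero.1 (Order.lt_one_iff.1 h))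
  have hnoa : a.count (Icc (-lam) 0 ×ˢ Ioc s s') = 0 →
      ∀ r ∈ Ioc s s', ∀ p ∈ Icc (-lam) 0, (p, r) ∉ a.pts := fun h r hr p hp hpr =>
    count_eq_zero.1 h _ hpr ⟨hp, hr⟩
  have hnod : d.count (Ioc s s') = 0 → ∀ r ∈ Ioc s s', r ∉ d.pts := fun h r hr hrd =>
    count_eq_zero.1 h _ hrd hr
  rcases hcases with ⟨ha, hd⟩ | ⟨ha, hd⟩ | ⟨ha, hd⟩
  · have hmark : slotMark lam s s' a d = -2 := by simp [slotMark, ha, hd]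
    rw [hmark, Inbox.act_of_lt h0 (by linarith)]
    refine ext_pts ?_
    rw [hx, hx']
    exact hX.eq_of_no_event_Ioc hs hss fun r hr => ⟨hnoa ha r hr, hnod hd r hr⟩
  · obtain ⟨⟨p, τ⟩, hpt⟩ := encard_eq_one.1 ha
    have hmem : (p, τ) ∈ a.pts ∩ Icc (-lam) 0 ×ˢ Ioc s s' := hpt ▸ mem_singleton _
    have hmark : slotMark lam s s' a d = p := by
      simp [slotMark, ha, hd, hpt]
    have huniq : ∀ r ∈ Ioc s s', r ≠ τ → ∀ q ∈ Icc (-lam) 0, (q, r) ∉ a.pts :=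
      fun r hr hne q hq hqr => hne (by
        have : (q, r) ∈ a.pts ∩ Icc (-lam) 0 ×ˢ Ioc s s' := ⟨hqr, hq, hr⟩
        rw [hpt] at this
        exact (Prod.mk.inj this).2)
    have hτ := hmem.2.2
    rw [hmark, Inbox.act_of_nonpos hmem.2.1.2]
    refine ext_pts ?_
    rw [Inbox.insertTask_of_mem hmem.2.1, hx, hx',
      hX.eq_of_no_event_Ioc (hs.trans hτ.1.le) hτ.2 fun r hr =>
        ⟨huniq r ⟨hτ.1.trans hr.1, hr.2⟩ hr.1.ne', hnod hd r ⟨hτ.1.trans hr.1, hr.2⟩⟩,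
      (hX.rules_of_no_event hs hτ.1 fun r hr =>
        ⟨huniq r ⟨hr.1, hr.2.le.trans hτ.2⟩ hr.2.ne,
          hnod hd r ⟨hr.1, hr.2.le.trans hτ.2⟩⟩).1 p hmem.2.1 hmem.1, union_singleton]
  · obtain ⟨τ, hpt⟩ := encard_eq_one.1 hd
    have hmem : τ ∈ d.pts ∩ Ioc s s' := hpt ▸ mem_singleton _
    have hmark : slotMark lam s s' a d = 1 := by simp [slotMark, ha, hd]
    have huniq : ∀ r ∈ Ioc s s', r ≠ τ → r ∉ d.pts := fun r hr hne hrd => hne (by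
      have : r ∈ d.pts ∩ Ioc s s' := ⟨hrd, hr⟩
      rwa [hpt] at this)
    have hτ := hmem.2
    rw [hmark, Inbox.act_of_pos one_pos]
    refine ext_pts ?_
    rw [Inbox.pts_removeMax, hx, hx',
      hX.eq_of_no_event_Ioc (hs.trans hτ.1.le) hτ.2 fun r hr =>
        ⟨hnoa ha r ⟨hτ.1.trans hr.1, hr.2⟩, huniq r ⟨hτ.1.trans hr.1, hr.2⟩ hr.1.ne'⟩,
      (hX.rules_of_no_event hs hτ.1 fun r hr =>
        ⟨hnoa ha r ⟨hr.1, hr.2.le.trans hτ.2⟩,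
          huniq r ⟨hr.1, hr.2.le.trans hτ.2⟩ hr.2.ne⟩).2.1 hmem.1]

end IsInboxPath

open LocFin

/-! ### Bounds for the lazy chain -/

namespace Inbox

variable {lam : ℝ}

theorem stepOp_linear (rho : Measure ℝ) [SFinite rho] (c c' : ℝ≥0∞) {f g : Inbox lam → ℝ≥0∞}
    (hf : Measurable f) (hg : Measurable g) :
    stepOp rho (fun y => c * f y + c' * g y) = fun y => c * stepOp rho f y + c' * stepOp rho g y := by
  funext y
  have hm : Measurable fun u : ℝ => act u y :=
    measurable_act.comp (measurable_id.prodMk measurable_const)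
  have hf' : Measurable fun u : ℝ => f (act u y) := hf.comp hm
  have hg' : Measurable fun u : ℝ => g (act u y) := hg.comp hm
  rw [stepOp, lintegral_add_left (hf'.const_mul c), lintegral_const_mul c hf',
    lintegral_const_mul c' hg', stepOp, stepOp]

theorem iterate_stepOp_linear (rho : Measure ℝ) [SFinite rho] (c c' : ℝ≥0∞)
    {f g : Inbox lam → ℝ≥0∞} (hf : Measurable f) (hg : Measurable g) (m : ℕ) :
    (stepOp rho)^[m] (fun y => c * f y + c' * g y) =
      fun y => c * (stepOp rho)^[m] f y + c' * (stepOp rho)^[m] g y := by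
  induction m with
  | zero => rfl
  | succ m ih =>
    rw [Function.iterate_succ_apply', ih, stepOp_linear rho c c'
      (measurable_iterate_stepOp rho hf m) (measurable_iterate_stepOp rho hg m)]
    simp only [Function.iterate_succ_apply']

/-- A lazy version of a chain inherits geometric bounds along the iterates of the chain. -/
theorem iterate_lazy_le {rho nu : Measure ℝ} [SFinite rho] [SFinite nu] {c c' r b x : ℝ≥0∞}
    (hc : c' + c = 1) (hr : c' + c * 2⁻¹ = r)
    (hstep : ∀ f : Inbox lam → ℝ≥0∞, Measurable f →
      stepOp rho f = fun y => c' * f y + c * stepOp nu f y)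
    {f : Inbox lam → ℝ≥0∞} (hf : Measurable f) {y : Inbox lam}
    (hb : ∀ j, (stepOp nu)^[j] f y ≤ b + x * 2⁻¹ ^ j) (m j : ℕ) :
    (stepOp rho)^[m] ((stepOp nu)^[j] f) y ≤ b + x * 2⁻¹ ^ j * r ^ m := by
  -- Each lazy step keeps `j` or advances it to `j + 1`, so the bound is needed for all `j`.
  -- Advancing costs a factor one half, and averaging gives `r`.
  induction m generalizing j with
  | zero => simpa using hb j
  | succ m ih =>
    have hj := measurable_iterate_stepOp nu hf j
    rw [Function.iterate_succ_apply, hstep _ hj,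
      iterate_stepOp_linear rho c' c hj (measurable_stepOp nu hj) m]
    have h1 := ih j
    have h2 := ih (j + 1)
    rw [Function.iterate_succ_apply'] at h2
    calc _ ≤ c' * (b + x * 2⁻¹ ^ j * r ^ m) + c * (b + x * 2⁻¹ ^ (j + 1) * r ^ m) :=
          add_le_add (mul_le_mul_right h1 _) (mul_le_mul_right h2 _)
      _ = (c' + c) * b + x * 2⁻¹ ^ j * r ^ m * (c' + c * 2⁻¹) := by ring
      _ = _ := by rw [hc, hr, one_mul, pow_succ]; ring

/-- The number `K` of embedded steps in `m` slots is binomial with parameter `2 * slotRate lam h`,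
so the mean of `2⁻¹ ^ K` is `(1 - slotRate lam h) ^ m`. Markov's inequality then bounds the
probability that `K < J` by the last term; the proof encodes this without introducing `K`. -/
theorem iterate_stepOp_slotLaw_le (h0 : 0 ≤ lam) (h1 : lam < 1) {h : ℝ} (hh : 0 ≤ h)
    (hh' : h ≤ 1 / 2) {A : Set (Inbox lam)} (hA : MeasurableSet A) (m J : ℕ) (y : Inbox lam) :
    (stepOp (slotLaw lam h))^[m] (A.indicator 1) y ≤
      markSeqLaw (stationaryWindow h1 ⁻¹' A) + exceedProb lam J y.size +
        2 ^ J * ENNReal.ofReal (1 - slotRate lam h) ^ m := by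
  have ha := slotRate_nonneg lam hh
  have ha' := slotRate_le h0 hh
  have hf : Measurable (A.indicator (1 : Inbox lam → ℝ≥0∞)) := measurable_one.indicator hA
  have hb : ∀ j, (stepOp markLaw)^[j] (A.indicator 1) y ≤
      markSeqLaw (stationaryWindow h1 ⁻¹' A) + exceedProb lam J y.size + 2 ^ J * 2⁻¹ ^ j := by
    intro j
    have hj := iterate_stepOp_indicator_le h0 h1 hA j y
    -- From `J` steps on the coupling estimate applies; for fewer steps the trivial bound one is at
    -- most `2 ^ J * 2⁻¹ ^ j`.
    rcases le_total J j with hJ | hJ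
    · refine hj.trans (le_add_right ?_)
      gcongr
      exact exceedProb_anti lam _ hJ
    · refine le_add_left ?_
      have hle : (stepOp markLaw)^[j] (A.indicator 1) y ≤ 1 := by
        rw [← lintegral_back markLaw hf]
        refine (lintegral_mono fun w => indicator_le_self' (fun _ _ => zero_le_one) _).trans ?_
        simp
      refine hle.trans ?_
      calc (1 : ℝ≥0∞) = 2 ^ j * 2⁻¹ ^ j := by
            rw [← mul_pow, ENNReal.mul_inv_cancel two_ne_zero ENNReal.ofNat_ne_top, one_pow]
        _ ≤ _ := by gcongr; exact one_le_two
  have e2 : ENNReal.ofReal (2 * slotRate lam h) = 2 * ENNReal.ofReal (slotRate lam h) := by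
    rw [ENNReal.ofReal_mul (by norm_num), ENNReal.ofReal_ofNat]
  have hfin := iterate_lazy_le (rho := slotLaw lam h) (nu := markLaw)
    (c := ENNReal.ofReal (2 * slotRate lam h)) (c' := ENNReal.ofReal (1 - 2 * slotRate lam h))
    (r := ENNReal.ofReal (1 - slotRate lam h)) (by
      rw [← ENNReal.ofReal_add (by linarith) (by linarith)]; simp) (by
      rw [e2, mul_comm 2 (ENNReal.ofReal (slotRate lam h)), mul_assoc, ENNReal.mul_inv_cancel two_ne_zero ENNReal.ofNat_ne_top,
        mul_one, ← ENNReal.ofReal_add (by linarith) ha]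
      congr 1; ring)
    (fun f hf => funext fun y => stepOp_slotLaw h0 h1 hh hh' hf y) hf hb m 0
  simpa using hfin

end Inbox

/-! ### From the slot chain to the inbox process -/

namespace IsInboxProcess

open Inbox

variable {Ω : Type*} [MeasurableSpace Ω] {P : Measure Ω} [IsProbabilityMeasure P]
  {Pin : Ω → LocFin (Iic (0 : ℝ) ×ˢ Ici (0 : ℝ))} {Pout : Ω → LocFin (Ici (0 : ℝ))}
  {Y : ℝ → Ω → LocFin (Iic (0 : ℝ))} {lam : ℝ}

/-- The restriction of the inbox to the window `[-lam, 0]`. -/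
def window (lam : ℝ) (y : LocFin (Iic (0 : ℝ))) : Inbox lam :=
  y.restrict (Icc_subset_Iic_self : Icc (-lam) 0 ⊆ Iic 0)

theorem measurable_window (lam : ℝ) : Measurable (window lam) :=
  LocFin.measurable_restrict Icc_subset_Iic_self measurableSet_Icc

theorem measurable_slotMarks (lam h : ℝ) (m : ℕ) :
    Measurable fun (x : LocFin (Iic (0 : ℝ) ×ˢ Ici (0 : ℝ)) × LocFin (Ici (0 : ℝ)))
      (k : Fin m) => slotMark lam (k * h) ((k + 1) * h) x.1 x.2 := by
  refine measurable_pi_lambda _ fun k => ?_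
  have h1 := measurable_slotMark lam (k * h) ((k + 1) * h)
  exact h1

/-- Running the inbox with independent marks of law `rho` gives a Markov chain. -/
theorem measure_run_mem {rho : Measure ℝ} [IsFiniteMeasure rho] {m : ℕ} {M : Ω → Fin m → ℝ}
    {W : Ω → Inbox lam} (hM : Measurable M) (hW : Measurable W)
    (hlaw : P.map M = Measure.pi fun _ => rho) (hind : IndepFun M W P) {A : Set (Inbox lam)}
    (hA : MeasurableSet A) :
    P {ω | run m (M ω) (W ω) ∈ A} = ∫⁻ ω, (stepOp rho)^[m] (A.indicator 1) (W ω) ∂P := by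
  have hjoint := (indepFun_iff_map_prod_eq_prod_map_map hM.aemeasurable hW.aemeasurable).1 hind
  rw [hlaw] at hjoint
  have hf : Measurable (A.indicator (1 : Inbox lam → ℝ≥0∞)) := measurable_one.indicator hA
  have hset : MeasurableSet {p : (Fin m → ℝ) × Inbox lam | run m p.1 p.2 ∈ A} :=
    measurable_run m hA
  have := Measure.isProbabilityMeasure_map hW.aemeasurable (μ := P)
  calc P {ω | run m (M ω) (W ω) ∈ A}
      = P.map (fun ω => (M ω, W ω)) {p | run m p.1 p.2 ∈ A} :=
        (Measure.map_apply (hM.prodMk hW) hset).symm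
    _ = ∫⁻ p, A.indicator 1 (run m p.1 p.2) ∂(Measure.pi fun _ : Fin m => rho).prod (P.map W) := by
        rw [hjoint, ← lintegral_indicator_one hset]
        rfl
    _ = ∫⁻ y, (stepOp rho)^[m] (A.indicator 1) y ∂P.map W := by
        refine (lintegral_prod_symm' (fun p : (Fin m → ℝ) × Inbox lam =>
          A.indicator 1 (run m p.1 p.2)) (hf.comp (measurable_run m))).trans ?_
        simp_rw [lintegral_run rho hf]
    _ = _ := lintegral_map (measurable_iterate_stepOp _ hf m) hW

theorem measure_run_slotMarks (hY : IsInboxProcess P Pin Pout Y) (h0 : 0 ≤ lam) {h : ℝ}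
    (hh : 0 ≤ h) (m : ℕ) {A : Set (Inbox lam)} (hA : MeasurableSet A) :
    P {ω | run m (fun k : Fin m => slotMark lam (k * h) ((k + 1) * h) (Pin ω) (Pout ω))
        (window lam (Y 0 ω)) ∈ A} =
      ∫⁻ ω, (stepOp (slotLaw lam h))^[m] (A.indicator 1) (window lam (Y 0 ω)) ∂P :=
  measure_run_mem
    ((measurable_slotMarks lam h m).comp
      (hY.poisson_in.measurable.prodMk hY.poisson_out.measurable))
    ((measurable_window lam).comp (hY.measurable 0 le_rfl))
    (map_slotMarks hY.poisson_in hY.poisson_out hY.indep_in_out h0 hh m)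
    (hY.indep_initial.symm.comp (measurable_slotMarks lam h m) (measurable_window lam)) hA

omit [IsProbabilityMeasure P] in
theorem ae_window_eq_run (hY : IsInboxProcess P Pin Pout Y) (h0 : 0 ≤ lam) (h1 : lam < 1) {h : ℝ}
    (hh : 0 ≤ h) (m : ℕ) : ∀ᵐ ω ∂P,
      (∀ k : Fin m, (Pin ω).count (Icc (-lam) 0 ×ˢ Ioc (k * h) ((k + 1) * h)) +
        (Pout ω).count (Ioc (k * h) ((k + 1) * h)) ≤ 1) →
      window lam (Y (m * h) ω) =
        run m (fun k : Fin m => slotMark lam (k * h) ((k + 1) * h) (Pin ω) (Pout ω))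
          (window lam (Y 0 ω)) := by
  filter_upwards [hY.path lam h0] with ω hω hgood
  have := run_eq_of_forall_act m (fun k : ℕ => slotMark lam (k * h) ((k + 1) * h) (Pin ω) (Pout ω))
    (fun k : ℕ => window lam (Y (k * h) ω)) fun k hk =>
      hω.eq_act_slotMark h0 h1 (s := k * h) (s' := (k + 1) * h) (by positivity) (by nlinarith)
        (hgood ⟨k, hk⟩) rfl (by push_cast; rfl)
  simpa using this

/-- The three error terms are late coalescence, too few embedded steps, and a slot with more than
one event. Without such a slot the process almost surely equals the run with the slot marks. -/
theorem measure_window_le (hY : IsInboxProcess P Pin Pout Y) (h0 : 0 ≤ lam) (h1 : lam < 1) {h : ℝ}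
    (hh : 0 ≤ h) (hh' : h ≤ 1 / 2) (m J : ℕ) {A : Set (Inbox lam)} (hA : MeasurableSet A) :
    P {ω | window lam (Y (m * h) ω) ∈ A} ≤ markSeqLaw (stationaryWindow h1 ⁻¹' A) +
      ∫⁻ ω, exceedProb lam J (window lam (Y 0 ω)).size ∂P +
      2 ^ J * ENNReal.ofReal (1 - slotRate lam h) ^ m +
      m * ENNReal.ofReal (((1 + lam) * h) ^ 2) := by
  have hW : Measurable fun ω => window lam (Y 0 ω) :=
    (measurable_window lam).comp (hY.measurable 0 le_rfl)
  have he : Measurable fun ω => exceedProb lam J (window lam (Y 0 ω)).size :=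
    (measurable_of_countable (exceedProb lam J)).comp (measurable_size.comp hW)
  set G : Fin m → Set Ω := fun k =>
    {ω | ¬ ((Pin ω).count (Icc (-lam) 0 ×ˢ Ioc (k * h) ((k + 1) * h)) +
      (Pout ω).count (Ioc (k * h) ((k + 1) * h)) ≤ 1)}
  have hG : ∀ k, P (G k) ≤ ENNReal.ofReal (((1 + lam) * h) ^ 2) := fun k => by
    have hb := measureReal_slot_bad_le (s := k * h) (s' := (k + 1) * h) hY.poisson_in
      hY.poisson_out hY.indep_in_out h0 (by positivity) (by nlinarith)
    rw [show ((k : ℝ) + 1) * h - k * h = h by ring] at hb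
    exact (ENNReal.le_ofReal_iff_toReal_le (measure_ne_top _ _) (by positivity)).2 hb
  have hGu : P (⋃ k, G k) ≤ m * ENNReal.ofReal (((1 + lam) * h) ^ 2) := by
    refine (measure_iUnion_fintype_le P G).trans ((Finset.sum_le_sum fun k _ => hG k).trans ?_)
    simp
  refine (measure_mono_ae (t := {ω | run m (fun k : Fin m =>
    slotMark lam (k * h) ((k + 1) * h) (Pin ω) (Pout ω)) (window lam (Y 0 ω)) ∈ A} ∪
    ⋃ k, G k) ?_).trans ((measure_union_le _ _).trans (add_le_add ?_ hGu))
  · change ∀ᵐ ω ∂P, _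
    filter_upwards [hY.ae_window_eq_run h0 h1 hh m] with ω hω hωA
    by_cases hg : ω ∈ ⋃ k, G k
    · exact Or.inr hg
    · left
      have : window lam (Y (m * h) ω) ∈ A := hωA
      rw [hω fun k => not_not.1 fun hk => hg (mem_iUnion.2 ⟨k, hk⟩)] at this
      exact this
  · rw [hY.measure_run_slotMarks h0 hh m hA]
    refine (lintegral_mono fun ω => iterate_stepOp_slotLaw_le h0 h1 hh hh' hA m J _).trans ?_
    rw [lintegral_add_right _ measurable_const, lintegral_add_right _ he]
    simp

/-- Take `h = t / m` and let `m → ∞`. The error from slots with several events is `((1 + lam) * t) ^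
2 / m`, and `(1 - slotRate lam h) ^ m ≤ exp (-(m * slotRate lam h))`, where `m * slotRate lam h`
tends to `t`. -/
theorem measure_window_le_exp (hY : IsInboxProcess P Pin Pout Y) (h0 : 0 ≤ lam) (h1 : lam < 1)
    {t : ℝ} (ht : 0 ≤ t) (J : ℕ) {A : Set (Inbox lam)} (hA : MeasurableSet A) :
    P {ω | window lam (Y t ω) ∈ A} ≤ markSeqLaw (stationaryWindow h1 ⁻¹' A) +
      ∫⁻ ω, exceedProb lam J (window lam (Y 0 ω)).size ∂P +
      2 ^ J * ENNReal.ofReal (Real.exp (-t)) := by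
  set B := markSeqLaw (stationaryWindow h1 ⁻¹' A) +
    ∫⁻ ω, exceedProb lam J (window lam (Y 0 ω)).size ∂P
  have hdiv : ∀ c : ℝ, Tendsto (fun m : ℕ => c / (m : ℝ)) atTop (𝓝 0) := fun c =>
    tendsto_const_div_atTop_nhds_zero_nat c
  have hexp : Tendsto (fun m : ℕ => Real.exp (-(t * Real.exp (-((1 + lam) * (t / m))))))
      atTop (𝓝 (Real.exp (-t))) := by
    have h := ((hdiv t).const_mul (1 + lam)).neg.rexp.const_mul t |>.neg.rexp
    simpa using h
  have hlim : Tendsto (fun m : ℕ => B + 2 ^ J * ENNReal.ofReal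
      (Real.exp (-(t * Real.exp (-((1 + lam) * (t / m)))))) +
      ENNReal.ofReal (((1 + lam) * t) ^ 2 / m)) atTop
      (𝓝 (B + 2 ^ J * ENNReal.ofReal (Real.exp (-t)) + ENNReal.ofReal 0)) := by
    refine Tendsto.add (Tendsto.add tendsto_const_nhds ?_) (ENNReal.tendsto_ofReal (hdiv _))
    exact ENNReal.Tendsto.const_mul (ENNReal.tendsto_ofReal hexp)
      (Or.inr (ENNReal.pow_ne_top ENNReal.ofNat_ne_top))
  rw [ENNReal.ofReal_zero, add_zero] at hlim
  refine ge_of_tendsto hlim ?_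
  filter_upwards [eventually_gt_atTop 0, (hdiv t).eventually_le_const (u := 1 / 2) (by norm_num)]
    with m hm hm2
  have hm' : (m : ℝ) ≠ 0 := by positivity
  have hh : 0 ≤ t / m := by positivity
  have h := hY.measure_window_le h0 h1 hh hm2 m J hA
  rw [mul_div_cancel₀ t hm'] at h
  refine h.trans (add_le_add (add_le_add le_rfl (mul_le_mul_right ?_ _)) (le_of_eq ?_))
  · have hr : 0 ≤ 1 - slotRate lam (t / m) := by linarith [slotRate_le h0 hh]
    rw [← ENNReal.ofReal_pow hr]
    refine ENNReal.ofReal_le_ofReal ?_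
    calc (1 - slotRate lam (t / m)) ^ m ≤ Real.exp (-slotRate lam (t / m)) ^ m := by
          gcongr
          linarith [Real.add_one_le_exp (-slotRate lam (t / m))]
      _ = _ := by
          rw [← Real.exp_nat_mul, slotRate]
          congr 1
          field_simp
  · rw [← ENNReal.ofReal_natCast, ← ENNReal.ofReal_mul (by positivity)]
    congr 1
    field_simp

end IsInboxProcess

/-! ### Total variation and the conclusion -/

/-- One-sided bounds on probabilities of events bound the total variation distance. -/
theorem tvDist_le {α : Type*} [MeasurableSpace α] (μ ν : Measure α) [IsProbabilityMeasure μ]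
    [IsProbabilityMeasure ν] {δ : ℝ≥0∞} (h : ∀ A, MeasurableSet A → μ A ≤ ν A + δ) :
    tvDist μ ν ≤ 2 * δ := by
  rcases eq_or_ne δ ∞ with rfl | hδ
  · simp
  have hreal : ∀ A, MeasurableSet A → μ.real A - ν.real A ≤ δ.toReal := fun A hA => by
    have := ENNReal.toReal_mono (by finiteness) (h A hA)
    rw [ENNReal.toReal_add (by finiteness) hδ] at this
    simp only [← measureReal_def] at this
    linarith
  set s := μ.toSignedMeasure - ν.toSignedMeasure with hs
  have happ : ∀ A, MeasurableSet A → s A = μ.real A - ν.real A := fun A hA => by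
    rw [hs, _root_.sub_apply, Measure.toSignedMeasure_apply_measurable hA,
      Measure.toSignedMeasure_apply_measurable hA]
  obtain ⟨i, hi, hi2, hi3, hpos, hneg⟩ := s.toJordanDecomposition_spec
  have hbound : ∀ x : ℝ≥0, (x : ℝ) ≤ δ.toReal → (x : ℝ≥0∞) ≤ δ := fun x hx => by
    rw [← ENNReal.ofReal_coe_nnreal]
    exact ENNReal.ofReal_le_of_le_toReal hx
  rw [tvDist, ← hs, SignedMeasure.totalVariation, Measure.add_apply, hpos, hneg,
    SignedMeasure.toMeasureOfZeroLE_apply _ hi2 hi MeasurableSet.univ,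
    SignedMeasure.toMeasureOfLEZero_apply _ hi3 hi.compl MeasurableSet.univ, two_mul]
  refine add_le_add (hbound _ ?_) (hbound _ ?_)
  · rw [NNReal.coe_mk, inter_univ, happ i hi]
    exact hreal i hi
  -- Both measures have mass one, so the negative part has the same mass as the positive part and
  -- the one-sided bound covers it too.
  · rw [NNReal.coe_mk, inter_univ, happ _ hi.compl, probReal_compl_eq_one_sub hi,
      probReal_compl_eq_one_sub hi]
    linarith [hreal i hi]

/-- The number `J` is chosen before `t`. Dominated convergence makes the coupling error small for an
arbitrary random initial size, without moment assumptions; then `t` is taken large enough to beat `2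
^ J`. -/
theorem IsInboxProcess.tendsto_tvDist {Ω : Type*} [MeasurableSpace Ω] {P : Measure Ω}
    [IsProbabilityMeasure P] {Pin : Ω → LocFin (Iic (0 : ℝ) ×ˢ Ici (0 : ℝ))}
    {Pout : Ω → LocFin (Ici (0 : ℝ))} {Y : ℝ → Ω → LocFin (Iic (0 : ℝ))} {lam : ℝ}
    (hY : IsInboxProcess P Pin Pout Y) (h0 : 0 ≤ lam) (h1 : lam < 1) :
    Tendsto (fun t : ℝ => tvDist (P.map fun ω => window lam (Y t ω))
      (Inbox.markSeqLaw.map fun w => Inbox.stationaryWindow h1 w)) atTop (𝓝 0) := by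
  have hW : ∀ t, 0 ≤ t → Measurable fun ω => window lam (Y t ω) := fun t ht =>
    (measurable_window lam).comp (hY.measurable t ht)
  have hS := Inbox.measurable_stationaryWindow h1
  have hE : Tendsto (fun J => ∫⁻ ω, Inbox.exceedProb lam J (window lam (Y 0 ω)).size ∂P) atTop
      (𝓝 0) := by
    have := tendsto_lintegral_of_dominated_convergence (μ := P)
      (F := fun J ω => Inbox.exceedProb lam J (window lam (Y 0 ω)).size) (f := fun _ => 0)
      (fun _ => 1)
      (fun J => (measurable_of_countable (Inbox.exceedProb lam J)).comp
        (Inbox.measurable_size.comp (hW 0 le_rfl)))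
      (fun J => ae_of_all _ fun ω => Inbox.exceedProb_le_one _ _ _) (by simp)
      (ae_of_all _ fun ω => Inbox.tendsto_exceedProb h0 h1 _)
    simpa using this
  rw [ENNReal.tendsto_nhds_zero]
  intro ε hε
  have hε4 : 0 < ε / 4 := ENNReal.div_pos hε.ne' ENNReal.ofNat_ne_top
  obtain ⟨J, hJ⟩ := (hE.eventually_le_const hε4).exists
  have ht : Tendsto (fun t : ℝ => (2 : ℝ≥0∞) ^ J * ENNReal.ofReal (Real.exp (-t))) atTop (𝓝 0) := by
    have := ENNReal.Tendsto.const_mul (a := (2 : ℝ≥0∞) ^ J)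
      (ENNReal.tendsto_ofReal (Real.tendsto_exp_neg_atTop_nhds_zero))
      (Or.inr (ENNReal.pow_ne_top ENNReal.ofNat_ne_top))
    simpa using this
  filter_upwards [ht.eventually_le_const hε4, eventually_ge_atTop 0] with t htε ht0
  have := Measure.isProbabilityMeasure_map (μ := P) (hW t ht0).aemeasurable
  have := Measure.isProbabilityMeasure_map (μ := Inbox.markSeqLaw) hS.aemeasurable
  refine (tvDist_le _ _ (δ := ε / 4 + ε / 4) fun A hA => ?_).trans (le_of_eq ?_)
  · rw [Measure.map_apply (hW t ht0) hA, Measure.map_apply hS hA, ← add_assoc]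
    exact (hY.measure_window_le_exp h0 h1 ht0 J hA).trans
      (add_le_add (add_le_add le_rfl hJ) htε)
  · rw [← two_mul, ← mul_assoc]
    norm_num
    exact ENNReal.mul_div_cancel (by simp) (by simp)

theorem proposition1 :
    ∃ (Ω' : Type) (_ : MeasurableSpace Ω') (Q : Measure Ω') (_ : IsProbabilityMeasure Q)
      (Yinf : Ω' → LocFin (Ioc (-1 : ℝ) 0)),
      Measurable Yinf ∧
      (∀ {Ω : Type*} [MeasurableSpace Ω] (P : Measure Ω) [IsProbabilityMeasure P]
        (Pin : Ω → LocFin (Iic (0 : ℝ) ×ˢ Ici (0 : ℝ))) (Pout : Ω → LocFin (Ici (0 : ℝ)))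
        (Y : ℝ → Ω → LocFin (Iic (0 : ℝ))), IsInboxProcess P Pin Pout Y →
        ∀ (lam : ℝ) (_ : 0 < lam) (h1 : lam < 1),
          Tendsto
            (fun t : ℝ => tvDist
              (P.map fun ω => (Y t ω).restrict (Icc_subset_Iic_self : Icc (-lam) 0 ⊆ Iic 0))
              (Q.map fun ω => (Yinf ω).restrict (window_subset h1)))
            atTop (𝓝 0)) ∧
      (∀ᵐ ω ∂Q, (Yinf ω).pts.Infinite) ∧
      (∀ lam : ℝ, 0 ≤ lam → lam < 1 → ∀ n : ℕ,
        Q.real {ω | (Yinf ω).count (Icc (-lam) 0) = n} = (1 - lam) * lam ^ n) := by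
  refine ⟨ℕ → ℝ, inferInstance, Inbox.markSeqLaw, inferInstance, Inbox.stationary,
    Inbox.measurable_stationary, fun P _ Pin Pout Y hY lam h0 h1 => hY.tendsto_tvDist h0.le h1,
    Inbox.ae_infinite_stationary, fun lam h0 h1 n => Inbox.measure_count_stationary h0 h1 n⟩
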